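/- For an integer $n\ge 1$ let $p(n,m)$ be the number of partitions of $n$ into exactly $m$ positive integer summands (order disregarded, repetitions allowed), and let $$m(n)=\frac{\sum_{m\ge 0} m\,p(n,m)}{\sum_{m\ge 0} p(n,m)}$$ be the expected number of summands of a partition of $n$ chosen uniformly at random. Then, as $n\to\infty$, $$m(n)=\frac{\sqrt{6n}}{\pi}\left(\gamma+\log\frac{\sqrt{6n}}{\pi}\right)\left[1+\mathcal{O}\left(n^{-1/2}\right)\right],$$ where $\gamma$ is the Euler–Mascheroni constant. -/

import Mathlib

open Filter Asymptotics

/-- `p(n, m)`: the number of partitions of `n` (into positive integers) with exactly `m` summands,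
counted with multiplicity. -/
def numPartitionsInto (n m : ℕ) : ℕ :=
  Fintype.card {p : n.Partition // Multiset.card p.parts = m}

/-- The `k`-th moment `t_k(n) = ∑ₘ mᵏ p(n, m)`; the sum stops at `m = n` because a partition
of `n` has at most `n` summands. -/
def partitionMoment (k n : ℕ) : ℕ :=
  ∑ m ∈ Finset.range (n + 1), m ^ k * numPartitionsInto n m

/-- The expected number of summands `m(n) = t_1(n) / t_0(n)` of a partition of `n`. -/
noncomputable def expectedSummands (n : ℕ) : ℝ :=
  (partitionMoment 1 n : ℝ) / (partitionMoment 0 n : ℝ)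

/-!
Write `a m = p(m) e^{-αm}` for a parameter `α > 0`. Counting the occurrences of each part gives
`m(n) p(n) = ∑ₖ σ₀(k) p(n - k)` and `n p(n) = ∑ₖ σ₁(k) p(n - k)`, and both identities survive the
tilt by `e^{-αm}`. Fourier inversion and `e^{ikθ} = 1 + ikθ + O(k²θ²)` give
`a (n - k) = a n + k B + O(k² M)`, where `B` does not depend on `k` and `M = ∫ θ² |F(θ)| dθ` for
the generating function `F` of `a`. Inserting this in both identities and eliminating `B` yields
`m(n) = ∑ₖ σ₀(k) e^{-αk}` up to an error controlled by `M / a n` and `n - ∑ₖ σ₁(k) e^{-αk}`.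

For `α = π / √(6n)` the second quantity is `O(1 / α)`, and `F = exp (∑ₖ σ₁(k) e^{-αk} e^{ikθ} / k)`
concentrates on `|θ| ≍ α ^ (3 / 2)` without oscillating there against `e^{-inθ}`, whence
`M = O(α³ a n)`. Finally `∑ₖ σ₀(k) e^{-αk}` is the Lambert series `∑ᵣ 1 / (e^{αr} - 1)`, which is
`(γ - log α) / α + O(1)`.
-/

open Finset ArithmeticFunction
open scoped Topology

section Partitions

theorem card_parts_le {n : ℕ} (p : n.Partition) : Multiset.card p.parts ≤ n := by
  simpa [p.parts_sum] using
    Multiset.card_nsmul_le_sum (s := p.parts) (a := 1) fun _ hi ↦ p.parts_pos hi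

theorem mul_count_parts_le {n : ℕ} (p : n.Partition) (j : ℕ) : j * p.parts.count j ≤ n := by
  obtain ⟨u, hu⟩ := Multiset.le_iff_exists_add.1
    (Multiset.le_count_iff_replicate_le.1 (le_refl (p.parts.count j)))
  have := congrArg Multiset.sum hu
  rw [Multiset.sum_add, p.parts_sum, Multiset.sum_replicate, smul_eq_mul, mul_comm] at this
  omega

/-- Removing `r` copies of `j` is a bijection onto the partitions of `m`. -/
theorem card_partitions_le_count {n j r m : ℕ} (hj : 0 < j) (h : j * r + m = n) :
    #{p : n.Partition | r ≤ p.parts.count j} = Fintype.card m.Partition := by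
  have replicate_le {p : n.Partition} (hp : p ∈ ({p | r ≤ p.parts.count j} : Finset _)) :
      Multiset.replicate r j ≤ p.parts :=
    Multiset.le_count_iff_replicate_le.1 (by simpa using hp)
  rw [← card_univ]
  refine card_bij'
    (fun p hp ↦ ⟨p.parts - Multiset.replicate r j, fun hi ↦
      p.parts_pos (Multiset.mem_of_le (Multiset.sub_le_self _ _) hi), ?_⟩)
    (fun q _ ↦ ⟨q.parts + Multiset.replicate r j, fun hi ↦ ?_, ?_⟩)
    (fun _ _ ↦ mem_univ _) (fun _ _ ↦ by simp)
    (fun p hp ↦ Nat.Partition.ext (Multiset.sub_add_cancel (replicate_le hp)))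
    (fun _ _ ↦ Nat.Partition.ext (by simp))
  · have := congrArg Multiset.sum (Multiset.sub_add_cancel (replicate_le hp))
    rw [Multiset.sum_add, p.parts_sum, Multiset.sum_replicate, smul_eq_mul, mul_comm] at this
    omega
  · rcases Multiset.mem_add.1 hi with hi | hi
    · exact q.parts_pos hi
    · rwa [Multiset.eq_of_mem_replicate hi]
  · rw [Multiset.sum_add, q.parts_sum, Multiset.sum_replicate, smul_eq_mul, mul_comm r j]
    omega

variable {M : Type*} [AddCommMonoid M]

/-- The occurrences of `d` in `p` correspond to the multiples `k = d * r` with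
`1 ≤ r ≤ p.parts.count d`. -/
theorem sum_map_parts_eq_sum_divisors {n : ℕ} (p : n.Partition) (f : ℕ → M) :
    (p.parts.map f).sum = ∑ x ∈ antidiagonal n,
      ∑ d ∈ x.1.divisors with x.1 / d ≤ p.parts.count d, f d := by
  have count_smul (j : ℕ) : p.parts.count j • f j = ∑ _r ∈ Icc 1 (p.parts.count j), f j := by simp
  simp_rw [sum_multiset_map_count, count_smul]
  rw [sum_sigma', sum_sigma']
  refine sum_bij' (fun x _ ↦ ⟨(x.1 * x.2, n - x.1 * x.2), x.1⟩)
    (fun y _ ↦ ⟨y.2, y.1.1 / y.2⟩) ?_ ?_ ?_ ?_ (fun _ _ ↦ rfl)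
  · rintro ⟨j, r⟩ h
    simp only [mem_sigma, Multiset.mem_toFinset, mem_Icc] at h
    have j_pos := p.parts_pos h.1
    have le_n := (Nat.mul_le_mul_left j h.2.2).trans (mul_count_parts_le p j)
    simp only [mem_sigma, HasAntidiagonal.mem_antidiagonal, mem_filter, Nat.mem_divisors,
      Nat.mul_div_cancel_left r j_pos]
    exact ⟨by omega, ⟨Dvd.intro _ rfl, (Nat.mul_pos j_pos h.2.1).ne'⟩, h.2.2⟩
  · rintro ⟨⟨k, m⟩, d⟩ h
    simp only [mem_sigma, mem_filter, Nat.mem_divisors] at h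
    obtain ⟨-, ⟨hdk, hk⟩, hcount⟩ := h
    have quotient_pos : 0 < k / d := Nat.div_pos (Nat.le_of_dvd (Nat.pos_of_ne_zero hk) hdk)
      (Nat.pos_of_dvd_of_pos hdk (Nat.pos_of_ne_zero hk))
    simpa [Nat.succ_le_iff, quotient_pos, hcount] using
      Multiset.count_pos.1 (quotient_pos.trans_le hcount)
  · rintro ⟨j, r⟩ h
    simp only [mem_sigma, Multiset.mem_toFinset] at h
    simp [Nat.mul_div_cancel_left r (p.parts_pos h.1)]
  · rintro ⟨⟨k, m⟩, d⟩ h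
    simp only [mem_sigma, HasAntidiagonal.mem_antidiagonal, mem_filter, Nat.mem_divisors] at h
    have : n - k = m := by omega
    simp [Nat.mul_div_cancel' h.2.1.1, this]

theorem sum_partitions_sum_map_parts (f : ℕ → M) (n : ℕ) :
    ∑ p : n.Partition, (p.parts.map f).sum =
      ∑ x ∈ antidiagonal n, Fintype.card x.2.Partition • ∑ d ∈ x.1.divisors, f d := by
  simp_rw [sum_map_parts_eq_sum_divisors, sum_filter]
  rw [sum_comm]
  refine sum_congr rfl fun x hx ↦ ?_
  rw [sum_comm, smul_sum]
  refine sum_congr rfl fun d hd ↦ ?_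
  have mul_div_add : d * (x.1 / d) + x.2 = n := by
    rw [Nat.mul_div_cancel' (Nat.dvd_of_mem_divisors hd), HasAntidiagonal.mem_antidiagonal.1 hx]
  rw [← sum_filter, sum_const, card_partitions_le_count (Nat.pos_of_mem_divisors hd) mul_div_add]

theorem sum_mul_numPartitionsInto (g : ℕ → ℕ) (n : ℕ) :
    ∑ m ∈ range (n + 1), g m * numPartitionsInto n m =
      ∑ p : n.Partition, g (Multiset.card p.parts) := by
  rw [← sum_fiberwise_of_maps_to (t := range (n + 1)) (g := fun p ↦ Multiset.card p.parts)
    fun p _ ↦ mem_range.2 (Nat.lt_succ_of_le (card_parts_le p))]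
  refine sum_congr rfl fun m _ ↦ ?_
  rw [sum_congr rfl fun p hp ↦ congrArg g (mem_filter.1 hp).2, sum_const, smul_eq_mul, mul_comm,
    numPartitionsInto, Fintype.card_subtype]

theorem partitionMoment_zero (n : ℕ) : partitionMoment 0 n = Fintype.card n.Partition := by
  simpa [partitionMoment] using sum_mul_numPartitionsInto (fun _ ↦ 1) n

theorem partitionMoment_one (n : ℕ) : partitionMoment 1 n =
    ∑ x ∈ antidiagonal n, sigma 0 x.1 * Fintype.card x.2.Partition := by
  simpa [partitionMoment, sum_mul_numPartitionsInto (fun m ↦ m), sigma_zero_apply, mul_comm,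
    Multiset.map_const', Multiset.sum_replicate] using
      sum_partitions_sum_map_parts (fun _ ↦ (1 : ℕ)) n

theorem mul_card_partition (n : ℕ) : n * Fintype.card n.Partition =
    ∑ x ∈ antidiagonal n, sigma 1 x.1 * Fintype.card x.2.Partition := by
  simpa [Nat.Partition.parts_sum, sigma_one_apply, mul_comm] using
    sum_partitions_sum_map_parts (fun d ↦ d) n

end Partitions

section TrigSeries

theorem summable_pow_mul_of_le {c : ℕ → ℝ} {i j : ℕ} (hij : i ≤ j)
    (h : Summable fun k : ℕ ↦ (k : ℝ) ^ j * c k) : Summable fun k : ℕ ↦ (k : ℝ) ^ i * c k := by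
  refine h.abs.of_norm_bounded_eventually_nat ?_
  filter_upwards [eventually_ge_atTop 1] with k hk
  have : (1 : ℝ) ≤ k := by exact_mod_cast hk
  rw [Real.norm_eq_abs, abs_mul, abs_mul, abs_of_nonneg (by positivity : (0 : ℝ) ≤ (k : ℝ) ^ i),
    abs_of_nonneg (by positivity : (0 : ℝ) ≤ (k : ℝ) ^ j)]
  gcongr

theorem summable_of_summable_mul {c : ℕ → ℝ} (h : Summable fun k : ℕ ↦ k * c k) : Summable c := by
  simpa using summable_pow_mul_of_le zero_le_one (by simpa using h)

/-- The trigonometric series `∑ₖ cₖ e^{ikθ}`: the power series with coefficients `c`, on the unit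
circle. -/
noncomputable def trigSeries (c : ℕ → ℝ) (θ : ℝ) : ℂ :=
  ∑' k : ℕ, (c k : ℂ) * Complex.exp ((k * θ : ℝ) * Complex.I)

variable {c d : ℕ → ℝ}

theorem norm_trigSeries_term (c : ℕ → ℝ) (θ : ℝ) (k : ℕ) :
    ‖(c k : ℂ) * Complex.exp ((k * θ : ℝ) * Complex.I)‖ = |c k| := by
  rw [norm_mul, Complex.norm_exp_ofReal_mul_I, mul_one, Complex.norm_real, Real.norm_eq_abs]

theorem summable_norm_trigSeries_term (hc : Summable c) (θ : ℝ) :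
    Summable fun k : ℕ ↦ ‖(c k : ℂ) * Complex.exp ((k * θ : ℝ) * Complex.I)‖ := by
  simpa only [norm_trigSeries_term] using hc.abs

theorem trigSeries_zero (c : ℕ → ℝ) : trigSeries c 0 = (∑' k, c k : ℝ) := by
  simp [trigSeries, Complex.ofReal_tsum]

theorem continuous_trigSeries (hc : Summable c) : Continuous (trigSeries c) :=
  continuous_tsum (fun k ↦ by fun_prop) hc.abs fun k θ ↦ (norm_trigSeries_term c θ k).le

theorem re_trigSeries (hc : Summable c) (θ : ℝ) :
    (trigSeries c θ).re = ∑' k : ℕ, c k * Real.cos (k * θ) := by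
  rw [trigSeries, Complex.re_tsum (summable_norm_trigSeries_term hc θ).of_norm]
  simp only [Complex.re_ofReal_mul, Complex.exp_ofReal_mul_I_re]

theorem im_trigSeries (hc : Summable c) (θ : ℝ) :
    (trigSeries c θ).im = ∑' k : ℕ, c k * Real.sin (k * θ) := by
  rw [trigSeries, Complex.im_tsum (summable_norm_trigSeries_term hc θ).of_norm]
  simp only [Complex.im_ofReal_mul, Complex.exp_ofReal_mul_I_im]

theorem hasDerivAt_trigSeries (hc : Summable fun k : ℕ ↦ k * c k) (θ : ℝ) :
    HasDerivAt (trigSeries c) (Complex.I * trigSeries (fun k ↦ k * c k) θ) θ := by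
  rw [trigSeries, ← tsum_mul_left]
  refine hasDerivAt_tsum (u := fun k : ℕ ↦ |k * c k|) (y₀ := 0)
    (g' := fun k z ↦ Complex.I * (((k * c k : ℝ) : ℂ) * Complex.exp ((k * z : ℝ) * Complex.I)))
    hc.abs (fun k z ↦ ?_) (fun k z ↦ ?_)
    (summable_norm_trigSeries_term (summable_of_summable_mul hc) 0).of_norm θ
  · have phase : HasDerivAt (fun z : ℝ ↦ ((k * z : ℝ) : ℂ) * Complex.I) (k * Complex.I) z := by
      simpa using (((hasDerivAt_id z).const_mul (k : ℝ)).ofReal_comp).mul_const Complex.I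
    refine (phase.cexp.const_mul (c k : ℂ)).congr_deriv ?_
    push_cast
    ring
  · rw [norm_mul, Complex.norm_I, one_mul, norm_trigSeries_term (fun k : ℕ ↦ k * c k)]

theorem trigSeries_mul_trigSeries (hc : Summable c) (hd : Summable d) (θ : ℝ) :
    trigSeries c θ * trigSeries d θ =
      trigSeries (fun n ↦ ∑ x ∈ antidiagonal n, c x.1 * d x.2) θ := by
  rw [trigSeries, trigSeries, tsum_mul_tsum_eq_tsum_sum_antidiagonal_of_summable_norm
    (summable_norm_trigSeries_term hc θ) (summable_norm_trigSeries_term hd θ), trigSeries]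
  refine tsum_congr fun n ↦ ?_
  rw [Complex.ofReal_sum, sum_mul]
  refine sum_congr rfl fun x hx ↦ ?_
  have exp_add : Complex.exp ((n * θ : ℝ) * Complex.I) =
      Complex.exp ((x.1 * θ : ℝ) * Complex.I) * Complex.exp ((x.2 * θ : ℝ) * Complex.I) := by
    rw [← Complex.exp_add, ← HasAntidiagonal.mem_antidiagonal.1 hx]
    push_cast
    ring_nf
  rw [exp_add]
  push_cast
  ring

/-- The recurrence satisfied by the coefficients `c` of `exp (∑ₖ ℓₖ zᵏ)`, together with enough
summability for both series to be differentiable on the unit circle. -/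
structure HasLogCoeffs (c ℓ : ℕ → ℝ) : Prop where
  summable_mul : Summable fun k : ℕ ↦ k * c k
  summable_mul_log : Summable fun k : ℕ ↦ k * ℓ k
  mul_eq (n : ℕ) : n * c n = ∑ x ∈ antidiagonal n, x.1 * ℓ x.1 * c x.2

namespace HasLogCoeffs

variable {ℓ : ℕ → ℝ}

theorem summable (h : HasLogCoeffs c ℓ) : Summable c := summable_of_summable_mul h.summable_mul

theorem summable_log (h : HasLogCoeffs c ℓ) : Summable ℓ :=
  summable_of_summable_mul h.summable_mul_log

/-- The derivative of `trigSeries c θ * exp (-trigSeries ℓ θ)` vanishes. -/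
theorem trigSeries_eq (h : HasLogCoeffs c ℓ) (θ : ℝ) :
    trigSeries c θ =
      (∑' m, c m : ℝ) * Complex.exp (trigSeries ℓ θ - (∑' k, ℓ k : ℝ)) := by
  have logarithmic_derivative (θ : ℝ) : trigSeries (fun k ↦ k * c k) θ =
      trigSeries (fun k ↦ k * ℓ k) θ * trigSeries c θ := by
    rw [trigSeries_mul_trigSeries h.summable_mul_log h.summable]
    exact congrFun (congrArg trigSeries (funext h.mul_eq)) θ
  have deriv_zero (θ : ℝ) :
      HasDerivAt (fun θ ↦ trigSeries c θ * Complex.exp (-trigSeries ℓ θ)) 0 θ := by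
    refine ((hasDerivAt_trigSeries h.summable_mul θ).mul
      (hasDerivAt_trigSeries h.summable_mul_log θ).neg.cexp).congr_deriv ?_
    rw [logarithmic_derivative]
    ring
  have const := is_const_of_deriv_eq_zero (fun θ ↦ (deriv_zero θ).differentiableAt)
    (fun θ ↦ (deriv_zero θ).deriv) θ 0
  rw [trigSeries_zero, trigSeries_zero] at const
  rw [sub_eq_add_neg, add_comm, Complex.exp_add, ← mul_assoc, ← const, mul_assoc,
    ← Complex.exp_add, neg_add_cancel, Complex.exp_zero, mul_one]

theorem norm_trigSeries (h : HasLogCoeffs c ℓ) (hc : ∀ k, 0 ≤ c k) (θ : ℝ) :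
    ‖trigSeries c θ‖ =
      (∑' m, c m) * Real.exp (-∑' k : ℕ, ℓ k * (1 - Real.cos (k * θ))) := by
  have summable_cos : Summable fun k : ℕ ↦ ℓ k * Real.cos (k * θ) :=
    h.summable_log.abs.of_norm_bounded fun k ↦ by
      rw [norm_mul]
      exact mul_le_of_le_one_right (abs_nonneg _) (Real.abs_cos_le_one _)
  simp_rw [mul_sub, mul_one]
  rw [h.trigSeries_eq, norm_mul, Complex.norm_exp, Complex.norm_real,
    Real.norm_of_nonneg (tsum_nonneg hc), Complex.sub_re, Complex.ofReal_re,
    re_trigSeries h.summable_log, h.summable_log.tsum_sub summable_cos, neg_sub]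

theorem re_trigSeries_mul_exp (h : HasLogCoeffs c ℓ) (hc : ∀ k, 0 ≤ c k) (φ θ : ℝ) :
    (trigSeries c θ * Complex.exp ((-φ : ℝ) * Complex.I)).re =
      ‖trigSeries c θ‖ * Real.cos (∑' k : ℕ, ℓ k * Real.sin (k * θ) - φ) := by
  rw [h.trigSeries_eq, norm_mul, Complex.norm_exp, Complex.norm_real,
    Real.norm_of_nonneg (tsum_nonneg hc), mul_assoc, ← Complex.exp_add, Complex.re_ofReal_mul,
    Complex.exp_re, ← im_trigSeries h.summable_log, mul_assoc]
  simp [sub_eq_add_neg]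

end HasLogCoeffs

section Phase

variable {ℓ : ℕ → ℝ}

theorem abs_tsum_mul_sin_sub_le (hℓ : ∀ k, 0 ≤ ℓ k)
    (hs : Summable fun k : ℕ ↦ (k : ℝ) ^ 3 * ℓ k) (θ : ℝ) :
    |∑' k : ℕ, ℓ k * Real.sin (k * θ) - (∑' k : ℕ, k * ℓ k) * θ| ≤
      (∑' k : ℕ, (k : ℝ) ^ 3 * ℓ k) * (|θ| ^ 3 / 6) := by
  have summable_linear : Summable fun k : ℕ ↦ k * ℓ k := by
    simpa using summable_pow_mul_of_le (by norm_num : 1 ≤ 3) hs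
  have term_bound (k : ℕ) : ‖ℓ k * Real.sin (k * θ) - k * ℓ k * θ‖ ≤
      (k : ℝ) ^ 3 * ℓ k * (|θ| ^ 3 / 6) := by
    calc ‖ℓ k * Real.sin (k * θ) - k * ℓ k * θ‖ = ℓ k * |k * θ - Real.sin (k * θ)| := by
          rw [← norm_neg, ← Real.norm_of_nonneg (hℓ k), ← Real.norm_eq_abs, ← norm_mul,
            Real.norm_of_nonneg (hℓ k)]
          ring_nf
      _ ≤ ℓ k * (|k * θ| ^ 3 / 6) :=
          mul_le_mul_of_nonneg_left (Real.abs_sub_sin_le _) (hℓ k)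
      _ = (k : ℝ) ^ 3 * ℓ k * (|θ| ^ 3 / 6) := by
          rw [abs_mul, Nat.abs_cast]
          ring
  have summable_sin : Summable fun k : ℕ ↦ ℓ k * Real.sin (k * θ) := by
    simpa using ((hs.mul_right _).of_norm_bounded term_bound).add (summable_linear.mul_right θ)
  rw [← tsum_mul_right, ← tsum_mul_right, ← summable_sin.tsum_sub (summable_linear.mul_right θ)]
  exact tsum_of_norm_bounded (hs.mul_right _).hasSum term_bound

theorem mul_one_sub_cos_nonneg (hℓ : ∀ k, 0 ≤ ℓ k) (θ : ℝ) (k : ℕ) :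
    0 ≤ ℓ k * (1 - Real.cos (k * θ)) :=
  mul_nonneg (hℓ k) (sub_nonneg.2 (Real.cos_le_one _))

theorem tsum_mul_one_sub_cos_le (hℓ : ∀ k, 0 ≤ ℓ k)
    (hs : Summable fun k : ℕ ↦ (k : ℝ) ^ 2 * ℓ k) (θ : ℝ) :
    ∑' k : ℕ, ℓ k * (1 - Real.cos (k * θ)) ≤ (∑' k : ℕ, (k : ℝ) ^ 2 * ℓ k) * (θ ^ 2 / 2) := by
  have term_bound (k : ℕ) :
      ℓ k * (1 - Real.cos (k * θ)) ≤ (k : ℝ) ^ 2 * ℓ k * (θ ^ 2 / 2) := by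
    have one_sub_cos_le : 1 - Real.cos (k * θ) ≤ (k * θ) ^ 2 / 2 := by
      linarith [Real.one_sub_sq_div_two_le_cos (x := k * θ)]
    linarith [mul_le_mul_of_nonneg_left one_sub_cos_le (hℓ k)]
  rw [← tsum_mul_right]
  exact ((hs.mul_right _).of_nonneg_of_le (mul_one_sub_cos_nonneg hℓ θ) term_bound).tsum_le_tsum
    term_bound (hs.mul_right _)

theorem tsum_mul_one_sub_cos_mono (hd : ∀ k, 0 ≤ d k) (hdℓ : ∀ k ≠ 0, d k ≤ ℓ k)
    (hs : Summable ℓ) (θ : ℝ) :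
    ∑' k : ℕ, d k * (1 - Real.cos (k * θ)) ≤ ∑' k : ℕ, ℓ k * (1 - Real.cos (k * θ)) := by
  have one_sub_cos_nonneg (k : ℕ) : 0 ≤ 1 - Real.cos (k * θ) := sub_nonneg.2 (Real.cos_le_one _)
  have term_le (k : ℕ) : d k * (1 - Real.cos (k * θ)) ≤ ℓ k * (1 - Real.cos (k * θ)) := by
    rcases eq_or_ne k 0 with rfl | hk
    · simp
    · exact mul_le_mul_of_nonneg_right (hdℓ k hk) (one_sub_cos_nonneg k)
  have summable_right : Summable fun k : ℕ ↦ ℓ k * (1 - Real.cos (k * θ)) :=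
    (hs.abs.mul_right 2).of_norm_bounded fun k ↦ by
      rw [norm_mul, Real.norm_of_nonneg (one_sub_cos_nonneg k), Real.norm_eq_abs]
      gcongr
      linarith [Real.neg_one_le_cos (k * θ)]
  exact (summable_right.of_nonneg_of_le (mul_one_sub_cos_nonneg hd θ) term_le).tsum_le_tsum
    term_le summable_right

end Phase

theorem trigSeries_geometric {r : ℝ} (hr0 : 0 ≤ r) (hr1 : r < 1) (θ : ℝ) :
    trigSeries (fun k ↦ r ^ k) θ = (1 - r * Complex.exp (θ * Complex.I))⁻¹ := by
  rw [← tsum_geometric_of_norm_lt_one, trigSeries]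
  · refine tsum_congr fun k ↦ ?_
    rw [mul_pow, ← Complex.exp_nat_mul]
    push_cast
    ring_nf
  · rwa [norm_mul, Complex.norm_exp_ofReal_mul_I, mul_one, Complex.norm_real,
      Real.norm_of_nonneg hr0]

theorem tsum_geometric_mul_one_sub_cos {r : ℝ} (hr0 : 0 ≤ r) (hr1 : r < 1) (θ : ℝ) :
    ∑' k : ℕ, r ^ k * (1 - Real.cos (k * θ)) =
      r * (1 + r) * (1 - Real.cos θ) /
        ((1 - r) * ((1 - r) ^ 2 + 2 * r * (1 - Real.cos θ))) := by
  have hr : 0 < 1 - r := sub_pos.2 hr1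
  have summable_geometric : Summable fun k : ℕ ↦ r ^ k := summable_geometric_of_lt_one hr0 hr1
  have summable_cos : Summable fun k : ℕ ↦ r ^ k * Real.cos (k * θ) :=
    summable_geometric.of_norm_bounded fun k ↦ by
      rw [norm_mul, Real.norm_of_nonneg (by positivity)]
      exact mul_le_of_le_one_right (by positivity) (Real.abs_cos_le_one _)
  have normSq_eq : Complex.normSq (1 - r * Complex.exp (θ * Complex.I)) =
      (1 - r) ^ 2 + 2 * r * (1 - Real.cos θ) := by
    rw [Complex.normSq_apply, Complex.sub_re, Complex.sub_im, Complex.re_ofReal_mul,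
      Complex.im_ofReal_mul, Complex.exp_ofReal_mul_I_re, Complex.exp_ofReal_mul_I_im,
      Complex.one_re, Complex.one_im]
    linear_combination r ^ 2 * Real.sin_sq_add_cos_sq θ
  have normSq_pos : 0 < (1 - r) ^ 2 + 2 * r * (1 - Real.cos θ) :=
    add_pos_of_pos_of_nonneg (by positivity)
      (mul_nonneg (by positivity) (sub_nonneg.2 (Real.cos_le_one θ)))
  simp_rw [mul_sub, mul_one]
  rw [summable_geometric.tsum_sub summable_cos, ← re_trigSeries summable_geometric,
    tsum_geometric_of_lt_one hr0 hr1, trigSeries_geometric hr0 hr1, Complex.inv_re, normSq_eq,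
    Complex.sub_re, Complex.re_ofReal_mul, Complex.exp_ofReal_mul_I_re, Complex.one_re,
    inv_eq_one_div, div_sub_div _ _ hr.ne' normSq_pos.ne']
  congr 1 <;> ring

end TrigSeries

section FourierCoefficients

variable {c : ℕ → ℝ}

theorem intervalIntegral_exp_int_mul_I (l : ℤ) :
    ∫ θ in (-Real.pi)..Real.pi, Complex.exp ((l * θ : ℝ) * Complex.I) =
      if l = 0 then (2 * Real.pi : ℂ) else 0 := by
  split_ifs with hl
  · simp only [hl, Int.cast_zero, zero_mul, Complex.ofReal_zero, Complex.exp_zero,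
      intervalIntegral.integral_const, Complex.real_smul, mul_one]
    push_cast
    ring
  · have frequency_ne_zero : (l : ℂ) * Complex.I ≠ 0 :=
      mul_ne_zero (by exact_mod_cast hl) Complex.I_ne_zero
    have exp_eq (θ : ℝ) : Complex.exp ((l * θ : ℝ) * Complex.I) =
        Complex.exp ((l : ℂ) * Complex.I * θ) := by
      push_cast
      ring_nf
    simp_rw [exp_eq]
    rw [integral_exp_mul_complex frequency_ne_zero, div_eq_zero_iff, sub_eq_zero]
    left
    rw [Complex.exp_eq_exp_iff_exists_int]
    exact ⟨l, by push_cast; ring⟩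

/-- The coefficient `c (n - k)`, where `c` is extended by zero to negative indices. -/
def shiftedCoeff (c : ℕ → ℝ) (n k : ℕ) : ℝ := if k ≤ n then c (n - k) else 0

/-- The integrand of the Fourier integral for the `n`-th coefficient of `trigSeries c`. -/
noncomputable def fourierIntegrand (c : ℕ → ℝ) (n : ℕ) (θ : ℝ) : ℂ :=
  trigSeries c θ * Complex.exp ((-(n * θ) : ℝ) * Complex.I)

theorem norm_fourierIntegrand (c : ℕ → ℝ) (n : ℕ) (θ : ℝ) :
    ‖fourierIntegrand c n θ‖ = ‖trigSeries c θ‖ := by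
  rw [fourierIntegrand, norm_mul, Complex.norm_exp_ofReal_mul_I, mul_one]

theorem continuous_fourierIntegrand (hc : Summable c) (n : ℕ) :
    Continuous (fourierIntegrand c n) := by
  have := continuous_trigSeries hc
  unfold fourierIntegrand
  fun_prop

theorem intervalIntegral_fourierIntegrand_mul_exp (hc : Summable c) (n k : ℕ) :
    ∫ θ in (-Real.pi)..Real.pi, fourierIntegrand c n θ * Complex.exp ((k * θ : ℝ) * Complex.I) =
      2 * Real.pi * shiftedCoeff c n k := by
  have term_eq (m : ℕ) (θ : ℝ) : (c m : ℂ) * Complex.exp ((m * θ : ℝ) * Complex.I) *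
      (Complex.exp ((-(n * θ) : ℝ) * Complex.I) * Complex.exp ((k * θ : ℝ) * Complex.I)) =
        c m * Complex.exp ((((m + k - n : ℤ) : ℝ) * θ : ℝ) * Complex.I) := by
    rw [mul_assoc, ← Complex.exp_add, ← Complex.exp_add]
    push_cast
    ring_nf
  have hasSum_integral := intervalIntegral.hasSum_integral_of_dominated_convergence
    (μ := MeasureTheory.volume) (a := -Real.pi) (b := Real.pi)
    (F := fun m θ ↦ (c m : ℂ) * Complex.exp ((((m + k - n : ℤ) : ℝ) * θ : ℝ) * Complex.I))
    (f := fun θ ↦ fourierIntegrand c n θ * Complex.exp ((k * θ : ℝ) * Complex.I))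
    (fun m _ ↦ |c m|) (fun m ↦ Continuous.aestronglyMeasurable (by fun_prop))
    (fun m ↦ .of_forall fun θ _ ↦ by
      rw [norm_mul, Complex.norm_exp_ofReal_mul_I, mul_one, Complex.norm_real, Real.norm_eq_abs])
    (.of_forall fun _ _ ↦ hc.abs) (by simp)
    (.of_forall fun θ _ ↦ by
      simpa only [term_eq, fourierIntegrand, mul_assoc, trigSeries] using
        (summable_norm_trigSeries_term hc θ).of_norm.hasSum.mul_right
          (Complex.exp ((-(n * θ) : ℝ) * Complex.I) * Complex.exp ((k * θ : ℝ) * Complex.I)))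
  rw [← hasSum_integral.tsum_eq]
  simp_rw [intervalIntegral.integral_const_mul, intervalIntegral_exp_int_mul_I]
  rw [shiftedCoeff]
  split_ifs with hk
  · rw [tsum_eq_single (n - k) fun m hm ↦ by rw [if_neg (by omega), mul_zero],
      if_pos (by omega), mul_comm]
  · rw [Complex.ofReal_zero, mul_zero, tsum_congr fun m ↦ by rw [if_neg (by omega), mul_zero],
      tsum_zero]

theorem intervalIntegral_fourierIntegrand (hc : Summable c) (n : ℕ) :
    ∫ θ in (-Real.pi)..Real.pi, fourierIntegrand c n θ = 2 * Real.pi * c n := by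
  simpa [shiftedCoeff] using intervalIntegral_fourierIntegrand_mul_exp hc n 0

/-- The integral that controls both the second-order Taylor remainder of the coefficients
`c (n - k)` in `k` and the tail of their Fourier integrals. -/
noncomputable def secondMoment (c : ℕ → ℝ) : ℝ :=
  ∫ θ in (-Real.pi)..Real.pi, θ ^ 2 * ‖trigSeries c θ‖

theorem secondMoment_nonneg (c : ℕ → ℝ) : 0 ≤ secondMoment c :=
  intervalIntegral.integral_nonneg (by linarith [Real.pi_pos]) fun _ _ ↦ by positivity

theorem norm_exp_ofReal_mul_I_sub_one_sub_le (x : ℝ) :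
    ‖Complex.exp (x * Complex.I) - 1 - x * Complex.I‖ ≤ 3 * x ^ 2 := by
  have norm_mul_I : ‖(x : ℂ) * Complex.I‖ = |x| := by simp
  rcases le_total |x| 1 with h | h
  · have := Complex.norm_exp_sub_one_sub_id_le (x := x * Complex.I) (by rwa [norm_mul_I])
    rw [norm_mul_I, sq_abs] at this
    nlinarith [sq_nonneg x]
  · calc ‖Complex.exp (x * Complex.I) - 1 - x * Complex.I‖
        ≤ ‖Complex.exp (x * Complex.I)‖ + ‖(1 : ℂ)‖ + ‖(x : ℂ) * Complex.I‖ :=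
          (norm_sub_le _ _).trans (by gcongr; exact norm_sub_le _ _)
      _ = 2 + |x| := by
          rw [Complex.norm_exp_ofReal_mul_I, norm_one, norm_mul_I]
          ring
      _ ≤ 3 * x ^ 2 := by
          rw [← sq_abs]
          nlinarith

/-- Expand `e^{ikθ} = 1 + ikθ + O(k²θ²)` in the Fourier integral for `c (n - k)`. -/
theorem exists_abs_shiftedCoeff_sub_le (hc : Summable c) (n : ℕ) :
    ∃ B : ℝ, ∀ k : ℕ, |shiftedCoeff c n k - c n - k * B| ≤ k ^ 2 * secondMoment c := by
  have hΨ := continuous_fourierIntegrand hc n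
  have hF := continuous_trigSeries hc
  set J : ℂ := ∫ θ in (-Real.pi)..Real.pi, fourierIntegrand c n θ * (θ * Complex.I) with hJ
  refine ⟨(J / (2 * Real.pi)).re, fun k ↦ ?_⟩
  have remainder_eq : 2 * Real.pi * (shiftedCoeff c n k - c n - k * (J / (2 * Real.pi))) =
      ∫ θ in (-Real.pi)..Real.pi, fourierIntegrand c n θ *
        (Complex.exp ((k * θ : ℝ) * Complex.I) - 1 - (k * θ : ℝ) * Complex.I) := by
    have : (Real.pi : ℂ) ≠ 0 := by exact_mod_cast Real.pi_ne_zero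
    calc 2 * Real.pi * (shiftedCoeff c n k - c n - k * (J / (2 * Real.pi)))
        = 2 * Real.pi * shiftedCoeff c n k - 2 * Real.pi * c n - k * J := by field_simp
      _ = _ := by
        rw [← intervalIntegral_fourierIntegrand hc, ← intervalIntegral_fourierIntegrand_mul_exp hc,
          hJ, ← intervalIntegral.integral_const_mul,
          ← intervalIntegral.integral_sub (Continuous.intervalIntegrable (by fun_prop) _ _)
            (Continuous.intervalIntegrable (by fun_prop) _ _),
          ← intervalIntegral.integral_sub (Continuous.intervalIntegrable (by fun_prop) _ _)
            (Continuous.intervalIntegrable (by fun_prop) _ _)]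
        congr 1 with θ
        push_cast
        ring
  have remainder_le : 2 * Real.pi * ‖(shiftedCoeff c n k - c n - k * (J / (2 * Real.pi)) : ℂ)‖ ≤
      3 * (k ^ 2 * secondMoment c) := by
    rw [← Complex.norm_of_nonneg Real.two_pi_pos.le, ← norm_mul, Complex.ofReal_mul,
      Complex.ofReal_ofNat, remainder_eq, secondMoment, ← intervalIntegral.integral_const_mul,
      ← intervalIntegral.integral_const_mul]
    refine intervalIntegral.norm_integral_le_of_norm_le (by linarith [Real.pi_pos])
      (.of_forall fun θ _ ↦ ?_) (Continuous.intervalIntegrable (by fun_prop) _ _)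
    rw [norm_mul, norm_fourierIntegrand]
    linarith [mul_le_mul_of_nonneg_left (norm_exp_ofReal_mul_I_sub_one_sub_le (k * θ))
      (norm_nonneg (trigSeries c θ))]
  have abs_le_norm : |shiftedCoeff c n k - c n - k * (J / (2 * Real.pi)).re| ≤
      ‖(shiftedCoeff c n k - c n - k * (J / (2 * Real.pi)) : ℂ)‖ := by
    simpa using Complex.abs_re_le_norm (shiftedCoeff c n k - c n - k * (J / (2 * Real.pi)) : ℂ)
  nlinarith [Real.pi_gt_three, abs_nonneg (shiftedCoeff c n k - c n - k * (J / (2 * Real.pi)).re),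
    abs_le_norm]

theorem intervalIntegral_re_fourierIntegrand (hc : Summable c) (n : ℕ) :
    ∫ θ in (-Real.pi)..Real.pi, (fourierIntegrand c n θ).re = 2 * Real.pi * c n := by
  have := Complex.reCLM.intervalIntegral_comp_comm (μ := MeasureTheory.volume)
    ((continuous_fourierIntegrand hc n).intervalIntegrable (-Real.pi) Real.pi)
  simpa [intervalIntegral_fourierIntegrand hc] using this

/-- Where the real part of the integrand may be negative, `T⁻² θ² ‖trigSeries c θ‖` compensates
for it. -/
theorem two_mul_mul_le_coeff_add_secondMoment (hc : Summable c) {n : ℕ} {T β m : ℝ} (hT : 0 < T)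
    (hβ0 : 0 ≤ β) (hβ : β ≤ Real.pi) (hre : ∀ θ, |θ| ≤ T → 0 ≤ (fourierIntegrand c n θ).re)
    (hm : ∀ θ, |θ| ≤ β → m ≤ (fourierIntegrand c n θ).re) :
    2 * β * m ≤ 2 * Real.pi * c n + secondMoment c / T ^ 2 := by
  have hF := continuous_trigSeries hc
  have continuous_re : Continuous fun θ ↦ (fourierIntegrand c n θ).re :=
    Complex.continuous_re.comp (continuous_fourierIntegrand hc n)
  set g : ℝ → ℝ := fun θ ↦ (fourierIntegrand c n θ).re + θ ^ 2 * ‖trigSeries c θ‖ / T ^ 2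
  have hg : Continuous g := by fun_prop
  have compensation_nonneg (θ : ℝ) : 0 ≤ θ ^ 2 * ‖trigSeries c θ‖ / T ^ 2 := by positivity
  have g_nonneg (θ : ℝ) : 0 ≤ g θ := by
    rcases le_total |θ| T with h | h
    · exact add_nonneg (hre θ h) (compensation_nonneg θ)
    · have neg_norm_le : -‖trigSeries c θ‖ ≤ (fourierIntegrand c n θ).re := by
        rw [← norm_fourierIntegrand c n]
        exact neg_le_of_abs_le (Complex.abs_re_le_norm _)
      have norm_le : ‖trigSeries c θ‖ ≤ θ ^ 2 * ‖trigSeries c θ‖ / T ^ 2 := by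
        rw [le_div_iff₀ (by positivity), mul_comm, ← sq_abs θ]
        gcongr
      linarith
  calc 2 * β * m = ∫ _ in (-β)..β, m := by
        rw [intervalIntegral.integral_const, smul_eq_mul]
        ring
    _ ≤ ∫ θ in (-β)..β, g θ :=
        intervalIntegral.integral_mono_on (by linarith) intervalIntegrable_const
          (hg.intervalIntegrable _ _) fun θ hθ ↦
            (hm θ (abs_le.2 hθ)).trans (le_add_of_nonneg_right (compensation_nonneg θ))
    _ ≤ ∫ θ in (-Real.pi)..Real.pi, g θ :=
        intervalIntegral.integral_mono_interval (by linarith) (by linarith) hβ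
          (.of_forall g_nonneg) (hg.intervalIntegrable _ _)
    _ = 2 * Real.pi * c n + secondMoment c / T ^ 2 := by
        rw [intervalIntegral.integral_add (continuous_re.intervalIntegrable _ _)
          (Continuous.intervalIntegrable (by fun_prop) _ _), intervalIntegral.integral_div,
          intervalIntegral_re_fourierIntegrand hc, secondMoment]

end FourierCoefficients

section Convolution

variable {a c v w : ℕ → ℝ}

theorem hasSum_mul_shiftedCoeff (w c : ℕ → ℝ) (n : ℕ) :
    HasSum (fun k ↦ w k * shiftedCoeff c n k) (∑ x ∈ antidiagonal n, w x.1 * c x.2) := by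
  have sum_eq : ∑ x ∈ antidiagonal n, w x.1 * c x.2 =
      ∑ k ∈ range n.succ, w k * shiftedCoeff c n k := by
    rw [Finset.Nat.sum_antidiagonal_eq_sum_range_succ_mk]
    refine sum_congr rfl fun k hk ↦ ?_
    rw [shiftedCoeff, if_pos (Nat.lt_succ_iff.1 (mem_range.1 hk))]
  rw [sum_eq]
  refine hasSum_sum_of_ne_finset_zero fun k hk ↦ ?_
  rw [shiftedCoeff, if_neg (by simpa using hk), mul_zero]

theorem abs_sum_antidiagonal_mul_sub_le (hw : ∀ k, 0 ≤ w k)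
    (hs : Summable fun k : ℕ ↦ (k : ℝ) ^ 2 * w k) {n : ℕ} {B M : ℝ}
    (hB : ∀ k : ℕ, |shiftedCoeff c n k - c n - k * B| ≤ k ^ 2 * M) :
    |∑ x ∈ antidiagonal n, w x.1 * c x.2 - (∑' k, w k) * c n - (∑' k : ℕ, k * w k) * B| ≤
      (∑' k : ℕ, (k : ℝ) ^ 2 * w k) * M := by
  have summable_zero : Summable w := by simpa using summable_pow_mul_of_le zero_le_two hs
  have summable_one : Summable fun k : ℕ ↦ k * w k := by
    simpa using summable_pow_mul_of_le one_le_two hs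
  rw [← (((hasSum_mul_shiftedCoeff w c n).sub
    (summable_zero.hasSum.mul_right _)).sub (summable_one.hasSum.mul_right _)).tsum_eq,
    ← Real.norm_eq_abs]
  refine tsum_of_norm_bounded (hs.hasSum.mul_right M) fun k ↦ ?_
  calc ‖w k * shiftedCoeff c n k - w k * c n - k * w k * B‖
      = w k * |shiftedCoeff c n k - c n - k * B| := by
        rw [← Real.norm_of_nonneg (hw k), ← Real.norm_eq_abs, ← norm_mul,
          Real.norm_of_nonneg (hw k)]
        ring_nf
    _ ≤ (k : ℝ) ^ 2 * w k * M := by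
        linarith [mul_le_mul_of_nonneg_left (hB k) (hw k)]

/-- Both convolutions depend, up to second order, on the same linear coefficient `B`, which is
eliminated between them. -/
theorem tsum_mul_abs_sum_antidiagonal_sub_le (hc : Summable c) (hw : ∀ k, 0 ≤ w k)
    (hv : ∀ k, 0 ≤ v k) (hws : Summable fun k : ℕ ↦ (k : ℝ) ^ 2 * w k)
    (hvs : Summable fun k : ℕ ↦ (k : ℝ) ^ 2 * v k) (n : ℕ) :
    (∑' k : ℕ, k * v k) * |∑ x ∈ antidiagonal n, w x.1 * c x.2 - (∑' k, w k) * c n| ≤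
      (∑' k : ℕ, k * w k) * |∑ x ∈ antidiagonal n, v x.1 * c x.2 - (∑' k, v k) * c n| +
        ((∑' k : ℕ, k * w k) * (∑' k : ℕ, (k : ℝ) ^ 2 * v k) +
          (∑' k : ℕ, k * v k) * ∑' k : ℕ, (k : ℝ) ^ 2 * w k) * secondMoment c := by
  obtain ⟨B, hB⟩ := exists_abs_shiftedCoeff_sub_le hc n
  have hw1 : 0 ≤ ∑' k : ℕ, k * w k := tsum_nonneg fun k ↦ mul_nonneg k.cast_nonneg (hw k)
  have hv1 : 0 ≤ ∑' k : ℕ, k * v k := tsum_nonneg fun k ↦ mul_nonneg k.cast_nonneg (hv k)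
  have hwB := abs_sum_antidiagonal_mul_sub_le hw hws hB
  have hvB := abs_sum_antidiagonal_mul_sub_le hv hvs hB
  generalize ∑ x ∈ antidiagonal n, w x.1 * c x.2 - (∑' k, w k) * c n = x at hwB ⊢
  generalize ∑ x ∈ antidiagonal n, v x.1 * c x.2 - (∑' k, v k) * c n = y at hvB ⊢
  generalize ∑' k : ℕ, k * w k = w₁ at *
  generalize ∑' k : ℕ, k * v k = v₁ at *
  calc v₁ * |x| = |v₁ * (x - w₁ * B) - w₁ * (y - v₁ * B) + w₁ * y| := by
        rw [← abs_of_nonneg hv1, ← abs_mul, abs_of_nonneg hv1]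
        ring_nf
    _ ≤ v₁ * |x - w₁ * B| + w₁ * |y - v₁ * B| + w₁ * |y| := by
        refine (abs_add_le _ _).trans (add_le_add ((abs_sub _ _).trans_eq ?_) ?_)
        · rw [abs_mul, abs_mul, abs_of_nonneg hv1, abs_of_nonneg hw1]
        · rw [abs_mul, abs_of_nonneg hw1]
    _ ≤ _ := by linarith [mul_le_mul_of_nonneg_left hwB hv1, mul_le_mul_of_nonneg_left hvB hw1]

theorem exists_le_of_mul_eq_sum_antidiagonal (ha : ∀ n, 0 ≤ a n) (hw : ∀ k, 0 ≤ w k)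
    (hw0 : w 0 = 0) (hs : Summable w)
    (h : ∀ n : ℕ, n * a n = ∑ x ∈ antidiagonal n, w x.1 * a x.2) : ∃ C, ∀ n, a n ≤ C := by
  set N := ⌈∑' k, w k⌉₊
  set C := ∑ m ∈ range (N + 1), a m
  have C_nonneg : 0 ≤ C := sum_nonneg fun m _ ↦ ha m
  refine ⟨C, fun n ↦ ?_⟩
  induction n using Nat.strong_induction_on with
  | _ n ih =>
    rcases lt_or_ge n (N + 1) with hn | hn
    · exact single_le_sum (fun i _ ↦ ha i) (mem_range.2 hn)
    · have n_pos : (0 : ℝ) < n := by exact_mod_cast (N.succ_pos.trans_le hn)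
      refine le_of_mul_le_mul_left ?_ n_pos
      calc n * a n = ∑ x ∈ antidiagonal n, w x.1 * a x.2 := h n
        _ ≤ ∑ x ∈ antidiagonal n, w x.1 * C := by
            refine sum_le_sum fun x hx ↦ ?_
            have := HasAntidiagonal.mem_antidiagonal.1 hx
            rcases Nat.eq_zero_or_pos x.1 with h0 | h0
            · simp [h0, hw0]
            · exact mul_le_mul_of_nonneg_left (ih x.2 (by omega)) (hw _)
        _ = (∑ k ∈ range n.succ, w k) * C := by
            rw [Finset.Nat.sum_antidiagonal_eq_sum_range_succ_mk, sum_mul]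
        _ ≤ n * C := by
            gcongr
            exact (hs.sum_le_tsum _ fun k _ ↦ hw k).trans
              ((Nat.le_ceil _).trans (by exact_mod_cast (Nat.le_succ N).trans hn))

end Convolution

section ExpTilt

/-- Exponential tilting of a sequence: the coefficients of its generating function on the circle of
radius `e^{-α}`. -/
noncomputable def expTilt (α : ℝ) (c : ℕ → ℝ) (k : ℕ) : ℝ := c k * Real.exp (-(α * k))

variable {α : ℝ} {c : ℕ → ℝ}

theorem expTilt_nonneg (hc : ∀ k, 0 ≤ c k) (α : ℝ) (k : ℕ) : 0 ≤ expTilt α c k :=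
  mul_nonneg (hc k) (Real.exp_pos _).le

theorem exp_neg_mul_natCast (α : ℝ) (k : ℕ) : Real.exp (-(α * k)) = Real.exp (-α) ^ k := by
  rw [← Real.exp_nat_mul]
  ring_nf

theorem expTilt_half (α : ℝ) (c : ℕ → ℝ) (k : ℕ) :
    expTilt α c k = expTilt (α / 2) c k * Real.exp (-(α / 2 * k)) := by
  rw [expTilt, expTilt, mul_assoc, ← Real.exp_add]
  ring_nf

theorem sum_antidiagonal_expTilt_mul (α : ℝ) (c d : ℕ → ℝ) (n : ℕ) :
    ∑ x ∈ antidiagonal n, expTilt α c x.1 * expTilt α d x.2 =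
      expTilt α (fun n ↦ ∑ x ∈ antidiagonal n, c x.1 * d x.2) n := by
  rw [expTilt, sum_mul]
  refine sum_congr rfl fun x hx ↦ ?_
  have exp_add : Real.exp (-(α * n)) = Real.exp (-(α * x.1)) * Real.exp (-(α * x.2)) := by
    rw [← Real.exp_add, ← HasAntidiagonal.mem_antidiagonal.1 hx]
    push_cast
    ring_nf
  rw [exp_add, expTilt, expTilt]
  ring

theorem summable_pow_mul_exp_neg_mul (hα : 0 < α) (j : ℕ) :
    Summable fun k : ℕ ↦ (k : ℝ) ^ j * Real.exp (-(α * k)) := by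
  simp_rw [exp_neg_mul_natCast]
  refine summable_pow_mul_geometric_of_norm_lt_one j ?_
  rw [Real.norm_of_nonneg (Real.exp_pos _).le, Real.exp_lt_one_iff]
  linarith

theorem summable_pow_mul_expTilt_of_le_pow {d : ℕ} (hα : 0 < α) (hc0 : ∀ k, 0 ≤ c k)
    (hc : ∀ k, c k ≤ (k : ℝ) ^ d) (j : ℕ) :
    Summable fun k : ℕ ↦ (k : ℝ) ^ j * expTilt α c k := by
  refine (summable_pow_mul_exp_neg_mul hα (j + d)).of_nonneg_of_le
    (fun k ↦ mul_nonneg (by positivity) (expTilt_nonneg hc0 α k)) fun k ↦ ?_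
  rw [expTilt, pow_add, mul_assoc]
  gcongr
  exact hc k

theorem summable_pow_mul_expTilt_of_half_le {C : ℝ} (hα : 0 < α) (hc0 : ∀ k, 0 ≤ c k)
    (hc : ∀ k, expTilt (α / 2) c k ≤ C) (j : ℕ) :
    Summable fun k : ℕ ↦ (k : ℝ) ^ j * expTilt α c k := by
  refine ((summable_pow_mul_exp_neg_mul (half_pos hα) j).mul_left C).of_nonneg_of_le
    (fun k ↦ mul_nonneg (by positivity) (expTilt_nonneg hc0 α k)) fun k ↦ ?_
  rw [expTilt_half, mul_left_comm]
  exact mul_le_mul_of_nonneg_right (hc k) (by positivity)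

/-- Half of the exponential decay absorbs the factor `k ^ j`. -/
theorem tsum_pow_mul_expTilt_le (hα : 0 < α) (hc0 : ∀ k, 0 ≤ c k) (j : ℕ)
    (hs : Summable (expTilt (α / 2) c)) :
    ∑' k : ℕ, (k : ℝ) ^ j * expTilt α c k ≤
      j.factorial * (2 / α) ^ j * ∑' k, expTilt (α / 2) c k := by
  have pow_mul_exp_le (k : ℕ) :
      (k : ℝ) ^ j * Real.exp (-(α / 2 * k)) ≤ j.factorial * (2 / α) ^ j := by
    have h := Real.pow_div_factorial_le_exp (x := α / 2 * k) (by positivity) j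
    rw [div_le_iff₀ (by positivity), mul_pow] at h
    rw [Real.exp_neg, ← div_eq_mul_inv, div_le_iff₀ (Real.exp_pos _)]
    calc (k : ℝ) ^ j = (2 / α) ^ j * ((α / 2) ^ j * (k : ℝ) ^ j) := by
          rw [← mul_assoc, ← mul_pow, div_mul_div_cancel₀ hα.ne', div_self two_ne_zero, one_pow,
            one_mul]
      _ ≤ (2 / α) ^ j * (Real.exp (α / 2 * k) * j.factorial) := by gcongr
      _ = _ := by ring
  have term_le (k : ℕ) :
      (k : ℝ) ^ j * expTilt α c k ≤ j.factorial * (2 / α) ^ j * expTilt (α / 2) c k := by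
    rw [expTilt_half, mul_left_comm, mul_comm _ (expTilt (α / 2) c k)]
    exact mul_le_mul_of_nonneg_left (pow_mul_exp_le k) (expTilt_nonneg hc0 _ k)
  rw [← tsum_mul_left]
  exact ((hs.mul_left _).of_nonneg_of_le
    (fun k ↦ mul_nonneg (by positivity) (expTilt_nonneg hc0 α k)) term_le).tsum_le_tsum
      term_le (hs.mul_left _)

end ExpTilt

section LambertSeries

variable {α x : ℝ}

theorem norm_exp_neg_lt_one (hα : 0 < α) : ‖Real.exp (-α)‖ < 1 := by
  rw [Real.norm_of_nonneg (Real.exp_pos _).le, Real.exp_lt_one_iff]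
  linarith

theorem exp_neg_div_one_sub_exp_neg_sq (x : ℝ) :
    Real.exp (-x) / (1 - Real.exp (-x)) ^ 2 = 1 / (2 * (Real.cosh x - 1)) := by
  have two_mul_cosh_sub_one :
      2 * (Real.cosh x - 1) = (1 - Real.exp (-x)) ^ 2 / Real.exp (-x) := by
    rw [Real.cosh_eq, eq_div_iff (Real.exp_pos _).ne']
    linear_combination (Real.exp_add x (-x)).symm.trans (by simp : Real.exp (x + -x) = 1)
  rw [two_mul_cosh_sub_one, one_div_div]

theorem exp_neg_div_one_sub_exp_neg_sq_le (hx : 0 < x) :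
    Real.exp (-x) / (1 - Real.exp (-x)) ^ 2 ≤ 1 / x ^ 2 := by
  rw [exp_neg_div_one_sub_exp_neg_sq]
  have self_le_sinh : x / 2 ≤ Real.sinh (x / 2) := Real.self_le_sinh_iff.2 (half_pos hx).le
  have cosh_eq : Real.cosh x = 2 * Real.sinh (x / 2) ^ 2 + 1 := by
    have h := Real.cosh_two_mul (x / 2)
    rw [mul_div_cancel₀ x two_ne_zero, Real.cosh_sq] at h
    linarith
  gcongr
  nlinarith

theorem le_exp_neg_div_one_sub_exp_neg_sq (hx : 0 < x) :
    1 / x ^ 2 - 1 / 2 ≤ Real.exp (-x) / (1 - Real.exp (-x)) ^ 2 := by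
  have cosh_sub_one_pos : 0 < Real.cosh x - 1 := sub_pos.2 (Real.one_lt_cosh.2 hx.ne')
  have cosh_le : (Real.cosh x - 1) * Real.exp (-(x ^ 2 / 2)) ≤ x ^ 2 / 2 := by
    have h := mul_le_mul_of_nonneg_right (Real.cosh_le_exp_half_sq x)
      (Real.exp_pos (-(x ^ 2 / 2))).le
    rw [← Real.exp_add, add_neg_cancel, Real.exp_zero] at h
    linarith [Real.add_one_le_exp (-(x ^ 2 / 2))]
  have h : (Real.cosh x - 1) * (2 - x ^ 2) ≤ x ^ 2 := by
    nlinarith [Real.add_one_le_exp (-(x ^ 2 / 2))]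
  rw [exp_neg_div_one_sub_exp_neg_sq, div_sub_div _ _ (by positivity) two_ne_zero,
    div_le_div_iff₀ (by positivity) (by positivity)]
  linarith

/-- Weights `σ_s(k) e^{-αk}`, whose sums are the Lambert series `∑ r ^ s / (e^{αr} - 1)`. -/
noncomputable def divisorWeight (s : ℕ) (α : ℝ) : ℕ → ℝ := expTilt α fun k ↦ (sigma s k : ℝ)

theorem divisorWeight_nonneg (s : ℕ) (α : ℝ) (k : ℕ) : 0 ≤ divisorWeight s α k :=
  expTilt_nonneg (fun _ ↦ Nat.cast_nonneg _) α k

theorem divisorWeight_zero_right (s : ℕ) (α : ℝ) : divisorWeight s α 0 = 0 := by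
  simp [divisorWeight, expTilt]

theorem summable_pow_mul_divisorWeight (s : ℕ) (hα : 0 < α) (j : ℕ) :
    Summable fun k : ℕ ↦ (k : ℝ) ^ j * divisorWeight s α k :=
  summable_pow_mul_expTilt_of_le_pow (d := s + 1) hα (fun _ ↦ Nat.cast_nonneg _)
    (fun k ↦ by exact_mod_cast sigma_le_pow_succ s k) j

theorem summable_divisorWeight (s : ℕ) (hα : 0 < α) : Summable (divisorWeight s α) := by
  simpa using summable_pow_mul_divisorWeight s hα 0

theorem tsum_pow_mul_divisorWeight_le (s : ℕ) (hα : 0 < α) (j : ℕ) :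
    ∑' k : ℕ, (k : ℝ) ^ j * divisorWeight s α k ≤
      j.factorial * (2 / α) ^ j * ∑' k, divisorWeight s (α / 2) k :=
  tsum_pow_mul_expTilt_le hα (fun _ ↦ Nat.cast_nonneg _) j
    (summable_divisorWeight s (half_pos hα))

theorem tsum_divisorWeight_eq_tsum_pnat (s : ℕ) (α : ℝ) :
    ∑' k, divisorWeight s α k = ∑' k : ℕ+, sigma s k * Real.exp (-α) ^ (k : ℕ) := by
  rw [tsum_pnat_eq_tsum_of_eq_zero (f := fun k : ℕ ↦ (sigma s k : ℝ) * Real.exp (-α) ^ k)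
    (by simp)]
  simp only [divisorWeight, expTilt, exp_neg_mul_natCast]

theorem tsum_divisorWeight_one_eq (hα : 0 < α) : ∑' k, divisorWeight 1 α k =
    ∑' r : ℕ, Real.exp (-(α * (r + 1))) / (1 - Real.exp (-(α * (r + 1)))) ^ 2 := by
  rw [tsum_divisorWeight_eq_tsum_pnat, ← tsum_prod_pow_eq_tsum_sigma 1 (norm_exp_neg_lt_one hα),
    tsum_pnat_eq_tsum_succ (f := fun d : ℕ ↦ ∑' c : ℕ+, (c : ℝ) ^ 1 * Real.exp (-α) ^ (d * c))]
  refine tsum_congr fun r ↦ ?_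
  rw [← tsum_coe_mul_geometric_of_norm_lt_one (norm_exp_neg_lt_one (by positivity)),
    tsum_pnat_eq_tsum_of_eq_zero
      (f := fun c : ℕ ↦ (c : ℝ) ^ 1 * Real.exp (-α) ^ ((r + 1) * c)) (by simp)]
  refine tsum_congr fun c ↦ ?_
  rw [pow_one, pow_mul, ← exp_neg_mul_natCast]
  push_cast
  rfl

theorem hasSum_one_div_mul_succ_sq (α : ℝ) :
    HasSum (fun r : ℕ ↦ 1 / (α * (r + 1)) ^ 2) (Real.pi ^ 2 / (6 * α ^ 2)) := by
  have h := ((hasSum_nat_add_iff' 1).2 hasSum_zeta_two).mul_left (1 / α ^ 2)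
  simp only [range_one, sum_singleton, CharP.cast_eq_zero, ne_eq, OfNat.ofNat_ne_zero,
    not_false_eq_true, zero_pow, div_zero, sub_zero, div_mul_div_comm, one_mul] at h
  rw [mul_comm 6]
  refine h.congr_fun fun r ↦ ?_
  push_cast
  rw [mul_pow]

theorem summable_exp_neg_div_one_sub_exp_neg_sq (hα : 0 < α) : Summable fun r : ℕ ↦
    Real.exp (-(α * (r + 1))) / (1 - Real.exp (-(α * (r + 1)))) ^ 2 :=
  (hasSum_one_div_mul_succ_sq α).summable.of_nonneg_of_le (fun _ ↦ by positivity)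
    fun _ ↦ exp_neg_div_one_sub_exp_neg_sq_le (by positivity)

theorem tsum_divisorWeight_one_le (hα : 0 < α) :
    ∑' k, divisorWeight 1 α k ≤ Real.pi ^ 2 / (6 * α ^ 2) := by
  rw [tsum_divisorWeight_one_eq hα, ← (hasSum_one_div_mul_succ_sq α).tsum_eq]
  exact (summable_exp_neg_div_one_sub_exp_neg_sq hα).tsum_le_tsum
    (fun r ↦ exp_neg_div_one_sub_exp_neg_sq_le (by positivity))
    (hasSum_one_div_mul_succ_sq α).summable

theorem one_div_sq_sub_exp_neg_div_le (hx : 0 < x) :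
    1 / x ^ 2 - Real.exp (-x) / (1 - Real.exp (-x)) ^ 2 ≤ 4 / (1 + x) ^ 2 := by
  rcases le_total x 1 with h | h
  · have one_half_le : 1 / 2 ≤ 4 / (1 + x) ^ 2 := by
      rw [div_le_div_iff₀ (by norm_num) (by positivity)]
      nlinarith
    linarith [le_exp_neg_div_one_sub_exp_neg_sq hx]
  · have nonneg : 0 ≤ Real.exp (-x) / (1 - Real.exp (-x)) ^ 2 := by positivity
    have one_div_le : 1 / x ^ 2 ≤ 4 / (1 + x) ^ 2 := by
      rw [div_le_div_iff₀ (by positivity) (by positivity)]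
      nlinarith
    linarith

theorem sum_one_div_one_add_mul_sq_le (hα : 0 < α) (N : ℕ) :
    ∑ r ∈ range N, 1 / (1 + α * (r + 1)) ^ 2 ≤ 1 / α := by
  have term_le (r : ℕ) : 1 / (1 + α * (r + 1)) ^ 2 ≤
      1 / α * (1 / (1 + α * r) - 1 / (1 + α * ((r + 1 : ℕ) : ℝ))) := by
    have telescope : 1 / α * (1 / (1 + α * r) - 1 / (1 + α * ((r + 1 : ℕ) : ℝ))) =
        1 / ((1 + α * r) * (1 + α * (r + 1))) := by
      push_cast
      field_simp
      ring
    rw [telescope, sq]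
    gcongr
    linarith
  calc ∑ r ∈ range N, 1 / (1 + α * (r + 1)) ^ 2
      ≤ ∑ r ∈ range N, 1 / α * (1 / (1 + α * r) - 1 / (1 + α * ((r + 1 : ℕ) : ℝ))) :=
        sum_le_sum fun r _ ↦ term_le r
    _ = 1 / α * (1 - 1 / (1 + α * N)) := by
        rw [← mul_sum, sum_range_sub' fun r : ℕ ↦ 1 / (1 + α * (r : ℝ))]
        simp only [Nat.cast_zero, mul_zero, add_zero, div_one]
    _ ≤ 1 / α := mul_le_of_le_one_right (by positivity) (sub_le_self _ (by positivity))

theorem le_tsum_divisorWeight_one (hα : 0 < α) :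
    Real.pi ^ 2 / (6 * α ^ 2) - 4 / α ≤ ∑' k, divisorWeight 1 α k := by
  have hs := summable_exp_neg_div_one_sub_exp_neg_sq hα
  have hz := hasSum_one_div_mul_succ_sq α
  rw [tsum_divisorWeight_one_eq hα, ← hz.tsum_eq, sub_le_comm, ← hz.summable.tsum_sub hs]
  refine Real.tsum_le_of_sum_range_le
    (fun r ↦ sub_nonneg.2 (exp_neg_div_one_sub_exp_neg_sq_le (by positivity))) fun N ↦ ?_
  calc _ ≤ ∑ r ∈ range N, 4 / (1 + α * (r + 1)) ^ 2 :=
        sum_le_sum fun r _ ↦ one_div_sq_sub_exp_neg_div_le (by positivity)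
    _ = 4 * ∑ r ∈ range N, 1 / (1 + α * (r + 1)) ^ 2 := by simp only [mul_sum, mul_one_div]
    _ ≤ 4 / α := by
        rw [← mul_one_div]
        gcongr
        exact sum_one_div_one_add_mul_sq_le hα N

theorem tsum_pow_mul_divisorWeight_one_le (hα : 0 < α) (j : ℕ) :
    ∑' k : ℕ, (k : ℝ) ^ j * divisorWeight 1 α k ≤ j.factorial * (2 / α) ^ j * (8 / α ^ 2) := by
  refine (tsum_pow_mul_divisorWeight_le 1 hα j).trans ?_
  gcongr
  refine (tsum_divisorWeight_one_le (half_pos hα)).trans ?_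
  calc Real.pi ^ 2 / (6 * (α / 2) ^ 2) = Real.pi ^ 2 * (2 / 3) / α ^ 2 := by
        field_simp
        ring
    _ ≤ 8 / α ^ 2 := by
        gcongr
        nlinarith [Real.pi_lt_d2, Real.pi_pos]

theorem choose_two_le_mul_sigma_one (k : ℕ) : (k + 2).choose 2 ≤ (k + 1) * sigma 1 (k + 1) := by
  have le_sigma : k + 1 ≤ sigma 1 (k + 1) := by
    rw [sigma_one_apply]
    exact single_le_sum (f := fun d ↦ d) (fun _ _ ↦ Nat.zero_le _) (by simp)
  have choose_two_le : (k + 2).choose 2 ≤ (k + 1) * (k + 1) := by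
    rw [Nat.choose_two_right]
    refine Nat.div_le_of_le_mul ?_
    nlinarith [show k + 2 - 1 = k + 1 from rfl]
  exact choose_two_le.trans (Nat.mul_le_mul_left _ le_sigma)

theorem le_tsum_mul_divisorWeight_one (hα : 0 < α) :
    Real.exp (-α) / α ^ 3 ≤ ∑' k : ℕ, k * divisorWeight 1 α k := by
  have hsum := (hasSum_choose_mul_geometric_of_norm_lt_one 2 (norm_exp_neg_lt_one hα)).mul_left
    (Real.exp (-α))
  have hs : Summable fun k : ℕ ↦ k * divisorWeight 1 α k := by
    simpa using summable_pow_mul_divisorWeight 1 hα 1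
  have one_sub_pos : 0 < 1 - Real.exp (-α) := sub_pos.2 (Real.exp_lt_one_iff.2 (neg_lt_zero.2 hα))
  calc Real.exp (-α) / α ^ 3 ≤ Real.exp (-α) * (1 / (1 - Real.exp (-α)) ^ (2 + 1)) := by
        rw [mul_one_div]
        gcongr
        linarith [Real.add_one_le_exp (-α)]
    _ = ∑' k : ℕ, Real.exp (-α) * ((k + 2).choose 2 * Real.exp (-α) ^ k) := hsum.tsum_eq.symm
    _ ≤ ∑' k : ℕ, ((k + 1 : ℕ) : ℝ) * divisorWeight 1 α (k + 1) := by
        refine hsum.summable.tsum_le_tsum (fun k ↦ ?_) ((summable_nat_add_iff 1).2 hs)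
        rw [divisorWeight, expTilt, exp_neg_mul_natCast, pow_succ]
        calc _ = ((k + 2).choose 2 : ℝ) * (Real.exp (-α) ^ k * Real.exp (-α)) := by ring
          _ ≤ ((k + 1 : ℕ) * sigma 1 (k + 1) : ℝ) * (Real.exp (-α) ^ k * Real.exp (-α)) := by
            gcongr
            exact_mod_cast choose_two_le_mul_sigma_one k
          _ = _ := mul_assoc _ _ _
    _ = ∑' k : ℕ, k * divisorWeight 1 α k := by
        rw [hs.tsum_eq_zero_add, Nat.cast_zero, zero_mul, zero_add]

/-- An antiderivative of `1 / (e^x - 1) - 1 / x` with limit `0` at `0`. -/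
noncomputable def logOneSubExpDivSelf (x : ℝ) : ℝ := Real.log (1 - Real.exp (-x)) - Real.log x

theorem exp_sub_one_pos (hx : 0 < x) : 0 < Real.exp x - 1 :=
  sub_pos.2 (Real.one_lt_exp_iff.2 hx)

theorem one_sub_exp_neg_pos (hx : 0 < x) : 0 < 1 - Real.exp (-x) :=
  sub_pos.2 (Real.exp_lt_one_iff.2 (neg_lt_zero.2 hx))

theorem exp_neg_div_one_sub_exp_neg (x : ℝ) :
    Real.exp (-x) / (1 - Real.exp (-x)) = 1 / (Real.exp x - 1) := by
  rw [← mul_div_mul_left _ _ (Real.exp_pos x).ne', mul_sub, ← Real.exp_add, add_neg_cancel,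
    Real.exp_zero, mul_one]

theorem hasDerivAt_logOneSubExpDivSelf (hx : 0 < x) :
    HasDerivAt logOneSubExpDivSelf (1 / (Real.exp x - 1) - 1 / x) x := by
  have h : HasDerivAt (fun x : ℝ ↦ 1 - Real.exp (-x)) (Real.exp (-x)) x := by
    simpa using ((hasDerivAt_neg x).exp).const_sub 1
  have h := (h.log (one_sub_exp_neg_pos hx).ne').sub (Real.hasDerivAt_log hx.ne')
  rwa [exp_neg_div_one_sub_exp_neg, ← one_div] at h

theorem monotoneOn_one_div_exp_sub_one_sub_one_div :
    MonotoneOn (fun x : ℝ ↦ 1 / (Real.exp x - 1) - 1 / x) (Set.Ioi 0) := by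
  have hasDerivAt_sub (x : ℝ) (hx : 0 < x) :
      HasDerivAt (fun x : ℝ ↦ 1 / (Real.exp x - 1) - 1 / x)
        (1 / x ^ 2 - Real.exp (-x) / (1 - Real.exp (-x)) ^ 2) x := by
    have h := (((Real.hasDerivAt_exp x).sub_const 1).fun_inv (exp_sub_one_pos hx).ne').fun_sub
      (hasDerivAt_inv hx.ne')
    simp only [one_div]
    refine h.congr_deriv ?_
    have sq_eq : Real.exp (-x) / (1 - Real.exp (-x)) ^ 2 =
        Real.exp x / (Real.exp x - 1) ^ 2 := by
      rw [sq, ← div_div, exp_neg_div_one_sub_exp_neg, Real.exp_neg]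
      have := exp_sub_one_pos hx
      field_simp
    rw [sq_eq]
    ring
  refine monotoneOn_of_deriv_nonneg (convex_Ioi 0)
    (fun x hx ↦ (hasDerivAt_sub x hx).continuousAt.continuousWithinAt)
    (fun x hx ↦ (hasDerivAt_sub x (interior_subset hx)).differentiableAt.differentiableWithinAt)
    fun x hx ↦ ?_
  rw [(hasDerivAt_sub x (interior_subset hx)).deriv]
  exact sub_nonneg.2 (exp_neg_div_one_sub_exp_neg_sq_le (interior_subset hx))

theorem neg_le_logOneSubExpDivSelf (hx : 0 < x) : -x ≤ logOneSubExpDivSelf x := by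
  have mul_exp_le : x * Real.exp (-x) ≤ 1 - Real.exp (-x) := by
    have h := mul_le_mul_of_nonneg_right (Real.add_one_le_exp x) (Real.exp_pos (-x)).le
    rw [← Real.exp_add, add_neg_cancel, Real.exp_zero] at h
    linarith
  have h := Real.log_le_log (mul_pos hx (Real.exp_pos _)) mul_exp_le
  rw [Real.log_mul hx.ne' (Real.exp_pos _).ne', Real.log_exp] at h
  rw [logOneSubExpDivSelf]
  linarith

theorem logOneSubExpDivSelf_nonpos (hx : 0 < x) : logOneSubExpDivSelf x ≤ 0 :=
  sub_nonpos.2 <| Real.log_le_log (one_sub_exp_neg_pos hx) (by linarith [Real.add_one_le_exp (-x)])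

theorem one_div_exp_sub_one_sub_one_div_nonpos (hx : 0 < x) :
    1 / (Real.exp x - 1) - 1 / x ≤ 0 :=
  sub_nonpos.2 <| one_div_le_one_div_of_le hx (by linarith [Real.add_one_le_exp x])

theorem neg_one_le_one_div_exp_sub_one_sub_one_div (hx : 0 < x) :
    -1 ≤ 1 / (Real.exp x - 1) - 1 / x := by
  have one_div_le : 1 / x ≤ 1 / (1 - Real.exp (-x)) :=
    one_div_le_one_div_of_le (one_sub_exp_neg_pos hx) (by linarith [Real.add_one_le_exp (-x)])
  have one_div_eq : 1 / (1 - Real.exp (-x)) = 1 / (Real.exp x - 1) + 1 := by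
    rw [← exp_neg_div_one_sub_exp_neg, div_add_one (one_sub_exp_neg_pos hx).ne', add_sub_cancel]
  linarith

theorem slope_bounds_of_monotoneOn_deriv {Ψ ψ : ℝ → ℝ} {s : Set ℝ} {a b : ℝ} (hs : s.OrdConnected)
    (hΨ : ∀ x ∈ s, HasDerivAt Ψ (ψ x) x) (hψ : MonotoneOn ψ s) (ha : a ∈ s) (hb : b ∈ s)
    (hab : a < b) : (b - a) * ψ a ≤ Ψ b - Ψ a ∧ Ψ b - Ψ a ≤ (b - a) * ψ b := by
  obtain ⟨ξ, hξ, slope_eq⟩ := exists_hasDerivAt_eq_slope Ψ ψ hab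
    (fun x hx ↦ (hΨ x (hs.out ha hb hx)).continuousAt.continuousWithinAt)
    fun x hx ↦ hΨ x (hs.out ha hb (Set.Ioo_subset_Icc_self hx))
  have ξ_mem : ξ ∈ s := hs.out ha hb (Set.Ioo_subset_Icc_self hξ)
  have b_sub_a_pos : 0 < b - a := sub_pos.2 hab
  rw [eq_div_iff b_sub_a_pos.ne', mul_comm] at slope_eq
  rw [← slope_eq]
  exact ⟨mul_le_mul_of_nonneg_left (hψ ha ξ_mem hξ.1.le) b_sub_a_pos.le,
    mul_le_mul_of_nonneg_left (hψ ξ_mem hb hξ.2.le) b_sub_a_pos.le⟩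

theorem mul_sum_bounds_of_monotoneOn_deriv {Ψ ψ : ℝ → ℝ}
    (hΨ : ∀ x ∈ Set.Ioi 0, HasDerivAt Ψ (ψ x) x) (hψ : MonotoneOn ψ (Set.Ioi 0)) (hα : 0 < α)
    (N : ℕ) :
    Ψ (α * (N + 1)) - Ψ α + α * ψ α ≤ α * ∑ r ∈ range (N + 1), ψ (α * (r + 1)) ∧
      α * ∑ r ∈ range (N + 1), ψ (α * (r + 1)) ≤
        Ψ (α * (N + 1)) - Ψ α + α * ψ (α * (N + 1)) := by
  induction N with
  | zero => simp
  | succ N ih =>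
    have slope := slope_bounds_of_monotoneOn_deriv (a := α * (N + 1)) (b := α * ((N + 1 : ℕ) + 1))
      Set.ordConnected_Ioi hΨ hψ (Set.mem_Ioi.2 (by positivity)) (Set.mem_Ioi.2 (by positivity))
      (by push_cast; gcongr; linarith)
    rw [show α * (((N + 1 : ℕ) : ℝ) + 1) - α * (N + 1) = α by push_cast; ring] at slope
    rw [sum_range_succ, mul_add α (∑ _ ∈ _, _)]
    constructor <;> linarith

theorem hasSum_one_div_exp_mul_sub_one (hα : 0 < α) :
    HasSum (fun r : ℕ ↦ 1 / (Real.exp (α * (r + 1)) - 1)) (∑' k, divisorWeight 0 α k) := by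
  have hr := norm_exp_neg_lt_one hα
  set g : ℕ → ℝ := fun n ↦ (n : ℝ) ^ 0 * Real.exp (-α) ^ n / (1 - Real.exp (-α) ^ n)
  have g_succ (r : ℕ) : 1 / (Real.exp (α * (r + 1)) - 1) = g (r + 1) := by
    simp only [g, pow_zero, one_mul, ← exp_neg_mul_natCast, exp_neg_div_one_sub_exp_neg]
    push_cast
    rfl
  have hs : Summable fun r ↦ g (r + 1) :=
    (summable_nat_add_iff 1).2 (summable_norm_pow_mul_geometric_div_one_sub 0 hr)
  rw [tsum_divisorWeight_eq_tsum_pnat, ← tsum_pow_div_one_sub_eq_tsum_sigma hr 0,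
    tsum_pnat_eq_tsum_succ (f := g), funext g_succ]
  exact hs.hasSum

theorem tendsto_harmonic_add_logOneSubExpDivSelf (hα : 0 < α) :
    Tendsto (fun N : ℕ ↦ (harmonic (N + 1) : ℝ) + logOneSubExpDivSelf (α * (N + 1))) atTop
      (𝓝 (Real.eulerMascheroniConstant - Real.log α)) := by
  have exp_tendsto : Tendsto (fun N : ℕ ↦ Real.exp (-(α * ((N + 1 : ℕ) : ℝ)))) atTop (𝓝 0) :=
    Real.tendsto_exp_neg_atTop_nhds_zero.comp
      ((tendsto_natCast_atTop_atTop.comp (tendsto_add_atTop_nat 1)).const_mul_atTop hα)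
  have log_tendsto := (exp_tendsto.const_sub 1).log (by norm_num)
  rw [sub_zero, Real.log_one] at log_tendsto
  have h := (((tendsto_add_atTop_iff_nat 1).2 Real.tendsto_eulerMascheroniSeq').add
    log_tendsto).sub_const (Real.log α)
  rw [add_zero] at h
  refine h.congr fun N ↦ ?_
  rw [logOneSubExpDivSelf, Real.log_mul hα.ne' (by positivity), Real.eulerMascheroniSeq',
    if_neg N.succ_ne_zero]
  push_cast
  ring

theorem abs_mul_tsum_divisorWeight_zero_sub_le (hα : 0 < α) :
    |α * ∑' k, divisorWeight 0 α k - (Real.eulerMascheroniConstant - Real.log α)| ≤ α := by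
  have bounds := mul_sum_bounds_of_monotoneOn_deriv
    (fun x hx ↦ hasDerivAt_logOneSubExpDivSelf hx) monotoneOn_one_div_exp_sub_one_sub_one_div hα
  have mul_sum_eq (N : ℕ) :
      α * ∑ r ∈ range (N + 1), (1 / (Real.exp (α * (r + 1)) - 1) - 1 / (α * (r + 1))) =
        α * ∑ r ∈ range (N + 1), 1 / (Real.exp (α * (r + 1)) - 1) - harmonic (N + 1) := by
    rw [sum_sub_distrib, mul_sub, mul_sum _ fun r : ℕ ↦ 1 / (α * ((r : ℝ) + 1)), harmonic,
      Rat.cast_sum]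
    congr 1
    refine sum_congr rfl fun r _ ↦ ?_
    push_cast
    field_simp
  have sum_tendsto := ((tendsto_add_atTop_iff_nat 1).2
    (hasSum_one_div_exp_mul_sub_one hα).tendsto_sum_nat).const_mul α
  have main_tendsto := tendsto_harmonic_add_logOneSubExpDivSelf hα
  have one_div_sub_ge := neg_one_le_one_div_exp_sub_one_sub_one_div hα
  have Ψ_ge := neg_le_logOneSubExpDivSelf hα
  have Ψ_nonpos := logOneSubExpDivSelf_nonpos hα
  rw [abs_le]
  constructor
  · suffices Real.eulerMascheroniConstant - Real.log α - α ≤ α * ∑' k, divisorWeight 0 α k by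
      linarith
    refine le_of_tendsto_of_tendsto' (main_tendsto.sub_const α) sum_tendsto fun N ↦ ?_
    have := (bounds N).1
    rw [mul_sum_eq] at this
    nlinarith
  · suffices α * ∑' k, divisorWeight 0 α k ≤ Real.eulerMascheroniConstant - Real.log α + α by
      linarith
    refine le_of_tendsto_of_tendsto' sum_tendsto (main_tendsto.add_const α) fun N ↦ ?_
    have := (bounds N).2
    rw [mul_sum_eq] at this
    nlinarith [one_div_exp_sub_one_sub_one_div_nonpos (x := α * (N + 1)) (by positivity)]

end LambertSeries

section PartitionWeight

variable {α θ A : ℝ}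

/-- Tilted partition numbers `p(m) e^{-αm}`, which make the coefficients of the generating
function of partitions summable while keeping both convolution identities. -/
noncomputable def partitionWeight (α : ℝ) : ℕ → ℝ :=
  expTilt α fun m ↦ (Fintype.card m.Partition : ℝ)

/-- Taylor coefficients `σ₁(k) e^{-αk} / k` of the logarithm of the generating function of
`partitionWeight α`; the one of index `0` vanishes. -/
noncomputable def logWeight (α : ℝ) : ℕ → ℝ := expTilt α fun k ↦ (sigma 1 k : ℝ) / k

theorem partitionWeight_pos (α : ℝ) (n : ℕ) : 0 < partitionWeight α n :=
  mul_pos (Nat.cast_pos.2 Fintype.card_pos) (Real.exp_pos _)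

theorem partitionWeight_nonneg (α : ℝ) (n : ℕ) : 0 ≤ partitionWeight α n :=
  (partitionWeight_pos α n).le

theorem tsum_partitionWeight_nonneg (α : ℝ) : 0 ≤ ∑' m, partitionWeight α m :=
  tsum_nonneg (partitionWeight_nonneg α)

theorem mul_partitionWeight (α : ℝ) (n : ℕ) :
    n * partitionWeight α n =
      ∑ x ∈ antidiagonal n, divisorWeight 1 α x.1 * partitionWeight α x.2 := by
  rw [divisorWeight, partitionWeight, sum_antidiagonal_expTilt_mul, expTilt, expTilt, ← mul_assoc]
  congr 1
  exact_mod_cast mul_card_partition n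

theorem expectedSummands_mul_partitionWeight (α : ℝ) (n : ℕ) :
    expectedSummands n * partitionWeight α n =
      ∑ x ∈ antidiagonal n, divisorWeight 0 α x.1 * partitionWeight α x.2 := by
  have card_ne_zero : (Fintype.card n.Partition : ℝ) ≠ 0 := by exact_mod_cast Fintype.card_ne_zero
  rw [divisorWeight, partitionWeight, sum_antidiagonal_expTilt_mul, expTilt, expTilt, ← mul_assoc,
    expectedSummands, partitionMoment_zero, div_mul_cancel₀ _ card_ne_zero]
  congr 1
  exact_mod_cast partitionMoment_one n

theorem exists_partitionWeight_le (hα : 0 < α) : ∃ C, ∀ n, partitionWeight α n ≤ C :=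
  exists_le_of_mul_eq_sum_antidiagonal (partitionWeight_nonneg α) (divisorWeight_nonneg 1 α)
    (divisorWeight_zero_right 1 α) (summable_divisorWeight 1 hα) (mul_partitionWeight α)

theorem summable_mul_partitionWeight (hα : 0 < α) :
    Summable fun n : ℕ ↦ n * partitionWeight α n := by
  obtain ⟨C, hC⟩ := exists_partitionWeight_le (half_pos hα)
  simpa only [pow_one, partitionWeight] using
    summable_pow_mul_expTilt_of_half_le hα (fun _ ↦ Nat.cast_nonneg _) hC 1

theorem logWeight_nonneg (α : ℝ) (k : ℕ) : 0 ≤ logWeight α k :=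
  expTilt_nonneg (fun _ ↦ by positivity) α k

theorem mul_logWeight (α : ℝ) (k : ℕ) : k * logWeight α k = divisorWeight 1 α k := by
  rcases eq_or_ne k 0 with rfl | hk
  · simp [divisorWeight_zero_right]
  · rw [logWeight, divisorWeight, expTilt, expTilt, ← mul_assoc,
      mul_div_cancel₀ _ (Nat.cast_ne_zero.2 hk)]

theorem pow_succ_mul_logWeight (α : ℝ) (j k : ℕ) :
    (k : ℝ) ^ (j + 1) * logWeight α k = (k : ℝ) ^ j * divisorWeight 1 α k := by
  rw [pow_succ, mul_assoc, mul_logWeight]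

theorem summable_pow_succ_mul_logWeight (hα : 0 < α) (j : ℕ) :
    Summable fun k : ℕ ↦ (k : ℝ) ^ (j + 1) * logWeight α k := by
  simpa only [pow_succ_mul_logWeight] using summable_pow_mul_divisorWeight 1 hα j

theorem hasLogCoeffs_partitionWeight (hα : 0 < α) :
    HasLogCoeffs (partitionWeight α) (logWeight α) where
  summable_mul := summable_mul_partitionWeight hα
  summable_mul_log := by simpa only [mul_logWeight] using summable_divisorWeight 1 hα
  mul_eq n := by simpa only [mul_logWeight] using mul_partitionWeight α n

theorem exp_neg_pow_le_logWeight (α : ℝ) {k : ℕ} (hk : k ≠ 0) :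
    Real.exp (-α) ^ k ≤ logWeight α k := by
  have le_sigma : (k : ℝ) ≤ sigma 1 k := by
    rw [sigma_one_apply]
    exact_mod_cast single_le_sum (f := fun d ↦ d) (fun _ _ ↦ Nat.zero_le _)
      (Nat.mem_divisors_self k hk)
  have k_pos : (0 : ℝ) < k := by positivity
  rw [← exp_neg_mul_natCast]
  exact le_mul_of_one_le_left (Real.exp_pos _).le ((one_le_div k_pos).2 le_sigma)

theorem sq_div_le_tsum_exp_neg_pow_mul_one_sub_cos (hα : 0 < α) (hα6 : α ≤ 1 / 6)
    (hθ : |θ| ≤ Real.pi) :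
    θ ^ 2 / (4 * (α * (α ^ 2 + θ ^ 2))) ≤
      ∑' k : ℕ, Real.exp (-α) ^ k * (1 - Real.cos (k * θ)) := by
  set r := Real.exp (-α)
  have r_pos : 0 < r := Real.exp_pos _
  have one_sub_r_pos : 0 < 1 - r := one_sub_exp_neg_pos hα
  have one_sub_r_le : 1 - r ≤ α := by linarith [Real.add_one_le_exp (-α)]
  have one_sub_cos_le : 1 - Real.cos θ ≤ θ ^ 2 / 2 := by
    linarith [Real.one_sub_sq_div_two_le_cos (x := θ)]
  have le_one_sub_cos : θ ^ 2 / 5 ≤ 1 - Real.cos θ := by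
    have : 1 / 5 ≤ 2 / Real.pi ^ 2 := by
      rw [div_le_div_iff₀ (by norm_num) (by positivity)]
      nlinarith [Real.pi_lt_d2, Real.pi_pos]
    nlinarith [sq_nonneg θ, Real.cos_le_one_sub_mul_cos_sq hθ]
  have one_sub_cos_nonneg : 0 ≤ 1 - Real.cos θ := le_trans (by positivity) le_one_sub_cos
  have le_numerator : θ ^ 2 / 4 ≤ r * (1 + r) * (1 - Real.cos θ) := by
    have : 5 / 4 ≤ r * (1 + r) := by nlinarith
    linarith [mul_le_mul this le_one_sub_cos (by positivity) (by positivity)]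
  have factor_le : (1 - r) ^ 2 + 2 * r * (1 - Real.cos θ) ≤ α ^ 2 + θ ^ 2 := by
    have : r * (1 - Real.cos θ) ≤ 1 * (θ ^ 2 / 2) :=
      mul_le_mul (by linarith) one_sub_cos_le one_sub_cos_nonneg zero_le_one
    have : (1 - r) ^ 2 ≤ α ^ 2 := by gcongr
    linarith
  have : 0 < (1 - r) ^ 2 + 2 * r * (1 - Real.cos θ) := by positivity
  rw [tsum_geometric_mul_one_sub_cos r_pos.le (by linarith), ← div_div]
  gcongr

theorem sq_div_le_tsum_logWeight_mul_one_sub_cos (hα : 0 < α) (hα6 : α ≤ 1 / 6)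
    (hθ : |θ| ≤ Real.pi) :
    θ ^ 2 / (4 * (α * (α ^ 2 + θ ^ 2))) ≤ ∑' k : ℕ, logWeight α k * (1 - Real.cos (k * θ)) :=
  (sq_div_le_tsum_exp_neg_pow_mul_one_sub_cos hα hα6 hθ).trans <|
    tsum_mul_one_sub_cos_mono (fun _ ↦ by positivity) (fun _ ↦ exp_neg_pow_le_logWeight α)
      (hasLogCoeffs_partitionWeight hα).summable_log θ

theorem norm_trigSeries_partitionWeight_le (hα : 0 < α) (hα6 : α ≤ 1 / 6) (hθ : |θ| ≤ Real.pi) :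
    ‖trigSeries (partitionWeight α) θ‖ ≤ (∑' m, partitionWeight α m) *
      (Real.exp (-(1 / (8 * α ^ 3)) * θ ^ 2) + Real.exp (-(1 / (8 * α)))) := by
  rw [(hasLogCoeffs_partitionWeight hα).norm_trigSeries (partitionWeight_nonneg α)]
  refine mul_le_mul_of_nonneg_left ?_ (tsum_partitionWeight_nonneg α)
  refine (Real.exp_le_exp.2 (neg_le_neg
    (sq_div_le_tsum_logWeight_mul_one_sub_cos hα hα6 hθ))).trans ?_
  rcases le_total (θ ^ 2) (α ^ 2) with hle | hle
  · refine le_add_of_le_of_nonneg (Real.exp_le_exp.2 ?_) (Real.exp_pos _).le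
    rw [neg_mul, neg_le_neg_iff, one_div_mul_eq_div]
    apply div_le_div_of_nonneg_left (sq_nonneg θ) (by positivity)
    nlinarith
  · refine le_add_of_nonneg_of_le (Real.exp_pos _).le (Real.exp_le_exp.2 ?_)
    rw [neg_le_neg_iff, div_le_div_iff₀ (by positivity) (by positivity)]
    nlinarith

theorem sq_mul_exp_neg_le {b : ℝ} (hb : 0 < b) (θ : ℝ) :
    θ ^ 2 * Real.exp (-(2 * b) * θ ^ 2) ≤ 1 / b * Real.exp (-b * θ ^ 2) := by
  have mul_exp_le_one : b * θ ^ 2 * Real.exp (-(b * θ ^ 2)) ≤ 1 :=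
    (Real.mul_exp_neg_le_exp_neg_one _).trans (Real.exp_le_one_iff.2 (by norm_num))
  calc θ ^ 2 * Real.exp (-(2 * b) * θ ^ 2)
      = 1 / b * Real.exp (-b * θ ^ 2) * (b * θ ^ 2 * Real.exp (-(b * θ ^ 2))) := by
        rw [show -(2 * b) * θ ^ 2 = -b * θ ^ 2 + -(b * θ ^ 2) by ring, Real.exp_add]
        field_simp
    _ ≤ 1 / b * Real.exp (-b * θ ^ 2) := mul_le_of_le_one_right (by positivity) mul_exp_le_one

theorem sq_mul_norm_trigSeries_partitionWeight_le (hα : 0 < α) (hα6 : α ≤ 1 / 6)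
    (hθ : |θ| ≤ Real.pi) :
    θ ^ 2 * ‖trigSeries (partitionWeight α) θ‖ ≤ (∑' m, partitionWeight α m) *
      (16 * α ^ 3 * Real.exp (-(1 / (16 * α ^ 3)) * θ ^ 2) +
        Real.pi ^ 2 * Real.exp (-(1 / (8 * α)))) := by
  refine (mul_le_mul_of_nonneg_left (norm_trigSeries_partitionWeight_le hα hα6 hθ)
    (sq_nonneg θ)).trans ?_
  rw [mul_left_comm, mul_add]
  refine mul_le_mul_of_nonneg_left (add_le_add ?_ ?_) (tsum_partitionWeight_nonneg α)
  · have h := sq_mul_exp_neg_le (b := 1 / (16 * α ^ 3)) (by positivity) θ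
    rwa [one_div_one_div, show 2 * (1 / (16 * α ^ 3)) = 1 / (8 * α ^ 3) by field_simp; norm_num]
      at h
  · rw [← sq_abs]
    gcongr

theorem intervalIntegral_exp_neg_mul_sq_le {b : ℝ} (hb : 0 < b) :
    ∫ θ in (-Real.pi)..Real.pi, Real.exp (-b * θ ^ 2) ≤ √(Real.pi / b) := by
  rw [← integral_gaussian b, intervalIntegral.integral_of_le (by linarith [Real.pi_pos])]
  exact MeasureTheory.setIntegral_le_integral (integrable_exp_neg_mul_sq hb)
    (Eventually.of_forall fun _ ↦ (Real.exp_pos _).le)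

theorem sqrt_pi_div_le (hα : 0 < α) : √(Real.pi / (1 / (16 * α ^ 3))) ≤ 8 * (α * √α) := by
  rw [Real.sqrt_le_left (by positivity)]
  calc Real.pi / (1 / (16 * α ^ 3)) = 16 * Real.pi * α ^ 3 := by field_simp
    _ ≤ 16 * 4 * α ^ 3 := by
      gcongr
      exact Real.pi_le_four
    _ = (8 * (α * √α)) ^ 2 := by
      rw [mul_pow, mul_pow, Real.sq_sqrt hα.le]
      ring

theorem exp_neg_one_div_le (hα : 0 < α) (hα1 : α ≤ 1) :
    Real.exp (-(1 / (8 * α))) ≤ 120 * 8 ^ 5 * (α ^ 3 * (α * √α)) := by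
  have sqrt_le_one : √α ≤ 1 := Real.sqrt_le_one.2 hα1
  have le_exp := Real.pow_div_factorial_le_exp (x := 1 / (8 * α)) (by positivity) 5
  rw [Real.exp_neg]
  calc (Real.exp (1 / (8 * α)))⁻¹ ≤ ((1 / (8 * α)) ^ 5 / (Nat.factorial 5))⁻¹ :=
        inv_anti₀ (by positivity) le_exp
    _ = 120 * 8 ^ 5 * (α ^ 3 * (α * (√α * √α))) := by
      rw [Real.mul_self_sqrt hα.le, show (Nat.factorial 5 : ℝ) = 120 by norm_num [Nat.factorial]]
      field_simp
    _ ≤ 120 * 8 ^ 5 * (α ^ 3 * (α * √α)) := by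
      gcongr
      exact mul_le_of_le_one_left (Real.sqrt_nonneg α) sqrt_le_one

theorem exists_secondMoment_partitionWeight_le_tsum : ∃ K : ℝ, 0 < K ∧ ∀ α, 0 < α → α ≤ 1 / 6 →
    secondMoment (partitionWeight α) ≤ K * (α ^ 3 * (α * √α)) * ∑' m, partitionWeight α m := by
  refine ⟨128 + 2 * Real.pi ^ 3 * (120 * 8 ^ 5), by positivity, fun α hα hα6 ↦ ?_⟩
  have pi_pos := Real.pi_pos
  set Z := ∑' m, partitionWeight α m
  have Z_nonneg : 0 ≤ Z := tsum_partitionWeight_nonneg α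
  have continuous_series :=
    continuous_trigSeries (hasLogCoeffs_partitionWeight hα).summable
  have gaussian_le := (intervalIntegral_exp_neg_mul_sq_le
    (b := 1 / (16 * α ^ 3)) (by positivity)).trans (sqrt_pi_div_le hα)
  have tail_le := exp_neg_one_div_le hα (by linarith)
  calc secondMoment (partitionWeight α)
      ≤ ∫ θ in (-Real.pi)..Real.pi, Z * (16 * α ^ 3 * Real.exp (-(1 / (16 * α ^ 3)) * θ ^ 2) +
          Real.pi ^ 2 * Real.exp (-(1 / (8 * α)))) :=
        intervalIntegral.integral_mono_on (by linarith)
          (Continuous.intervalIntegrable (by fun_prop) _ _)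
          (Continuous.intervalIntegrable (by fun_prop) _ _)
          fun θ hθ ↦ sq_mul_norm_trigSeries_partitionWeight_le hα hα6 (abs_le.2 hθ)
    _ = Z * (16 * α ^ 3 * (∫ θ in (-Real.pi)..Real.pi, Real.exp (-(1 / (16 * α ^ 3)) * θ ^ 2)) +
          2 * Real.pi ^ 3 * Real.exp (-(1 / (8 * α)))) := by
        rw [intervalIntegral.integral_const_mul, intervalIntegral.integral_add
          (Continuous.intervalIntegrable (by fun_prop) _ _)
          (Continuous.intervalIntegrable (by fun_prop) _ _), intervalIntegral.integral_const_mul,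
          intervalIntegral.integral_const, smul_eq_mul]
        ring
    _ ≤ Z * (16 * α ^ 3 * (8 * (α * √α)) +
          2 * Real.pi ^ 3 * (120 * 8 ^ 5 * (α ^ 3 * (α * √α)))) := by gcongr
    _ = _ := by ring

theorem exp_neg_eight_mul_tsum_le_norm (hα : 0 < α) (hθ : θ ^ 2 ≤ α ^ 3) :
    Real.exp (-8) * ∑' m, partitionWeight α m ≤ ‖trigSeries (partitionWeight α) θ‖ := by
  rw [(hasLogCoeffs_partitionWeight hα).norm_trigSeries (partitionWeight_nonneg α), mul_comm]
  refine mul_le_mul_of_nonneg_left (Real.exp_le_exp.2 (neg_le_neg ?_))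
    (tsum_partitionWeight_nonneg α)
  calc ∑' k : ℕ, logWeight α k * (1 - Real.cos (k * θ))
      ≤ (∑' k : ℕ, (k : ℝ) ^ 2 * logWeight α k) * (θ ^ 2 / 2) :=
        tsum_mul_one_sub_cos_le (logWeight_nonneg α) (summable_pow_succ_mul_logWeight hα 1) θ
    _ = (∑' k : ℕ, (k : ℝ) ^ 1 * divisorWeight 1 α k) * (θ ^ 2 / 2) := by
        simp_rw [pow_succ_mul_logWeight]
    _ ≤ (Nat.factorial 1 * (2 / α) ^ 1 * (8 / α ^ 2)) * (α ^ 3 / 2) := by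
        gcongr
        exact tsum_pow_mul_divisorWeight_one_le hα 1
    _ = 8 := by
        rw [Nat.factorial_one]
        field_simp
        norm_num

theorem abs_tsum_divisorWeight_one_sub_le (hα : 0 < α) :
    |∑' k, divisorWeight 1 α k - Real.pi ^ 2 / (6 * α ^ 2)| ≤ 4 / α := by
  have four_div_pos : 0 < 4 / α := by positivity
  rw [abs_le]
  constructor
  · linarith [le_tsum_divisorWeight_one hα]
  · linarith [tsum_divisorWeight_one_le hα]

theorem abs_tsum_logWeight_mul_sin_sub_le (hα : 0 < α) (θ : ℝ) :
    |∑' k : ℕ, logWeight α k * Real.sin (k * θ) - Real.pi ^ 2 / (6 * α ^ 2) * θ| ≤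
      4 / α * |θ| + 32 / (3 * α ^ 4) * |θ| ^ 3 := by
  have linear_le : |(∑' k, divisorWeight 1 α k) * θ - Real.pi ^ 2 / (6 * α ^ 2) * θ| ≤
      4 / α * |θ| := by
    rw [← sub_mul, abs_mul]
    exact mul_le_mul_of_nonneg_right (abs_tsum_divisorWeight_one_sub_le hα) (abs_nonneg θ)
  have cubic_le : (∑' k : ℕ, (k : ℝ) ^ 2 * divisorWeight 1 α k) * (|θ| ^ 3 / 6) ≤
      32 / (3 * α ^ 4) * |θ| ^ 3 :=
    calc _ ≤ Nat.factorial 2 * (2 / α) ^ 2 * (8 / α ^ 2) * (|θ| ^ 3 / 6) := by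
          gcongr
          exact tsum_pow_mul_divisorWeight_one_le hα 2
      _ = _ := by
          rw [Nat.factorial_two]
          push_cast
          field_simp
          ring
  have sin_sub_le := abs_tsum_mul_sin_sub_le (logWeight_nonneg α)
    (summable_pow_succ_mul_logWeight hα 2) θ
  simp_rw [mul_logWeight, pow_succ_mul_logWeight] at sin_sub_le
  refine (abs_sub_le _ ((∑' k, divisorWeight 1 α k) * θ) _).trans ?_
  linarith

/-- For `n = π² / (6α²)` the phase of the Fourier integrand stays bounded up to the
scale `|θ| ≍ α ^ (3 / 2)` on which its modulus is concentrated. -/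
theorem half_norm_le_re_fourierIntegrand {n : ℕ} (hα : 0 < α) (hA : 1 ≤ A)
    (hn : (n : ℝ) = Real.pi ^ 2 / (6 * α ^ 2)) (hs : 15 * A ^ 3 * √α ≤ 1)
    (hθ : |θ| ≤ A * (α * √α)) :
    ‖trigSeries (partitionWeight α) θ‖ / 2 ≤ (fourierIntegrand (partitionWeight α) n θ).re := by
  rw [fourierIntegrand, (hasLogCoeffs_partitionWeight hα).re_trigSeries_mul_exp
    (partitionWeight_nonneg α), hn, div_eq_mul_one_div]
  refine mul_le_mul_of_nonneg_left ?_ (norm_nonneg _)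
  set φ := ∑' k : ℕ, logWeight α k * Real.sin (k * θ) - Real.pi ^ 2 / (6 * α ^ 2) * θ
  have abs_phase_le : |φ| ≤ 1 :=
    calc |φ| ≤ 4 / α * |θ| + 32 / (3 * α ^ 4) * |θ| ^ 3 := abs_tsum_logWeight_mul_sin_sub_le hα θ
      _ ≤ 4 / α * (A * (α * √α)) + 32 / (3 * α ^ 4) * (A * (α * √α)) ^ 3 := by gcongr
      _ = 4 * A * √α + 32 / 3 * A ^ 3 * √α := by
          rw [show (A * (α * √α)) ^ 3 = A ^ 3 * α ^ 3 * √α ^ 2 * √α by ring, Real.sq_sqrt hα.le]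
          field_simp
      _ ≤ 4 * A ^ 3 * √α + 32 / 3 * A ^ 3 * √α := by
          gcongr
          exact le_self_pow₀ hA three_ne_zero
      _ ≤ 15 * A ^ 3 * √α := by linarith [show 0 ≤ A ^ 3 * √α by positivity]
      _ ≤ 1 := hs
  have sq_le_one : φ ^ 2 ≤ 1 := (sq_le_one_iff_abs_le_one φ).2 abs_phase_le
  linarith [Real.one_sub_sq_div_two_le_cos (x := φ)]

theorem mul_tsum_partitionWeight_le {K : ℝ} {n : ℕ} (hα : 0 < α) (hα1 : α ≤ 1) (hA : 1 ≤ A)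
    (hA2 : A ^ 2 = 2 * K * Real.exp 8) (hs : 15 * A ^ 3 * √α ≤ 1)
    (hK : secondMoment (partitionWeight α) ≤ K * (α ^ 3 * (α * √α)) * ∑' m, partitionWeight α m)
    (hn : (n : ℝ) = Real.pi ^ 2 / (6 * α ^ 2)) :
    α * √α * ∑' m, partitionWeight α m ≤ 4 * Real.pi * Real.exp 8 * partitionWeight α n := by
  set Z := ∑' m, partitionWeight α m
  set β := α * √α
  have β_pos : 0 < β := by positivity
  have β_sq : β ^ 2 = α ^ 3 := by
    rw [mul_pow, Real.sq_sqrt hα.le]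
    ring
  have β_le_pi : β ≤ Real.pi := by
    linarith [mul_le_one₀ hα1 (Real.sqrt_nonneg α) (Real.sqrt_le_one.2 hα1), Real.pi_gt_three]
  have K_pos : 0 < K := by
    by_contra! h
    nlinarith [mul_nonneg (neg_nonneg.2 h) (Real.exp_pos 8).le]
  have re_ge {θ : ℝ} (hθ : |θ| ≤ A * β) := half_norm_le_re_fourierIntegrand hα hA hn hs hθ
  have coeff_ge := two_mul_mul_le_coeff_add_secondMoment (n := n) (m := Real.exp (-8) * Z / 2)
    (hasLogCoeffs_partitionWeight hα).summable (T := A * β) (by positivity) β_pos.le β_le_pi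
    (fun θ hθ ↦ le_trans (by positivity) (re_ge hθ)) fun θ hθ ↦ by
      have sq_le : θ ^ 2 ≤ α ^ 3 := by
        rw [← β_sq, ← sq_abs]
        gcongr
      linarith [exp_neg_eight_mul_tsum_le_norm hα sq_le,
        re_ge (hθ.trans (le_mul_of_one_le_left β_pos.le hA))]
  have error_le : secondMoment (partitionWeight α) / (A * β) ^ 2 ≤ β * (Real.exp (-8) * Z) / 2 := by
    rw [div_le_iff₀ (by positivity)]
    refine hK.trans_eq ?_
    rw [mul_pow, hA2, β_sq, Real.exp_neg]
    field_simp
  have exp_mul_exp_neg : Real.exp 8 * Real.exp (-8) = 1 := by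
    rw [← Real.exp_add, add_neg_cancel, Real.exp_zero]
  calc β * Z = Real.exp 8 * (β * (Real.exp (-8) * Z)) := by
        linear_combination -(β * Z) * exp_mul_exp_neg
    _ ≤ Real.exp 8 * (4 * Real.pi * partitionWeight α n) := by
        refine mul_le_mul_of_nonneg_left ?_ (Real.exp_pos 8).le
        linarith
    _ = _ := by ring

/-- The mass of the Fourier integral concentrates on `|θ| ≍ α ^ (3 / 2)` when `α` is the
saddle point `π / √(6n)`. -/
theorem exists_eventually_secondMoment_partitionWeight_le : ∃ K : ℝ, 0 < K ∧
    ∀ᶠ α in 𝓝[>] 0, ∀ n : ℕ, (n : ℝ) = Real.pi ^ 2 / (6 * α ^ 2) →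
      secondMoment (partitionWeight α) ≤ K * α ^ 3 * partitionWeight α n := by
  obtain ⟨K, K_pos, secondMoment_le⟩ := exists_secondMoment_partitionWeight_le_tsum
  set A := √(2 * (K + 1) * Real.exp 8)
  have A_sq : A ^ 2 = 2 * (K + 1) * Real.exp 8 := Real.sq_sqrt (by positivity)
  have one_le_A : 1 ≤ A := by
    rw [Real.one_le_sqrt]
    nlinarith [Real.add_one_le_exp 8]
  have eventually_small : ∀ᶠ α in 𝓝[>] (0 : ℝ), 15 * A ^ 3 * √α < 1 := by
    have h : Tendsto (fun α ↦ 15 * A ^ 3 * √α) (𝓝 0) (𝓝 (15 * A ^ 3 * √0)) :=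
      Continuous.tendsto (by fun_prop) 0
    exact (h.mono_left nhdsWithin_le_nhds).eventually_lt_const (by simp)
  refine ⟨(K + 1) * (4 * Real.pi * Real.exp 8), by positivity, ?_⟩
  filter_upwards [eventually_small, Ioc_mem_nhdsGT (show (0 : ℝ) < 1 / 6 by norm_num)]
    with α small ⟨hα, hα6⟩ n hn
  have moment_le : secondMoment (partitionWeight α) ≤
      (K + 1) * (α ^ 3 * (α * √α)) * ∑' m, partitionWeight α m := by
    refine (secondMoment_le α hα hα6).trans ?_
    refine mul_le_mul_of_nonneg_right ?_ (tsum_partitionWeight_nonneg α)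
    gcongr
    linarith
  calc secondMoment (partitionWeight α)
      ≤ (K + 1) * α ^ 3 * (α * √α * ∑' m, partitionWeight α m) := by linarith
    _ ≤ (K + 1) * α ^ 3 * (4 * Real.pi * Real.exp 8 * partitionWeight α n) := by
        refine mul_le_mul_of_nonneg_left ?_ (by positivity)
        exact mul_tsum_partitionWeight_le hα (by linarith) one_le_A A_sq small.le moment_le hn
    _ = _ := by ring

end PartitionWeight

section ExpectedSummands

variable {α : ℝ}

/-- The convolution with `σ₁` is known exactly because it equals `n p(n)`. -/
theorem tsum_mul_divisorWeight_one_mul_abs_expectedSummands_sub_le {n : ℕ} (hα : 0 < α)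
    (hn : (n : ℝ) = Real.pi ^ 2 / (6 * α ^ 2)) :
    (∑' k : ℕ, k * divisorWeight 1 α k) *
        (|expectedSummands n - ∑' k, divisorWeight 0 α k| * partitionWeight α n) ≤
      (∑' k : ℕ, k * divisorWeight 0 α k) * (4 / α * partitionWeight α n) +
        ((∑' k : ℕ, k * divisorWeight 0 α k) * (∑' k : ℕ, (k : ℝ) ^ 2 * divisorWeight 1 α k) +
          (∑' k : ℕ, k * divisorWeight 1 α k) * ∑' k : ℕ, (k : ℝ) ^ 2 * divisorWeight 0 α k) *
            secondMoment (partitionWeight α) := by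
  have elimination := tsum_mul_abs_sum_antidiagonal_sub_le
    (hasLogCoeffs_partitionWeight hα).summable (divisorWeight_nonneg 0 α) (divisorWeight_nonneg 1 α)
    (summable_pow_mul_divisorWeight 0 hα 2) (summable_pow_mul_divisorWeight 1 hα 2) n
  rw [← expectedSummands_mul_partitionWeight, ← mul_partitionWeight, ← sub_mul, ← sub_mul,
    abs_mul, abs_mul, abs_of_pos (partitionWeight_pos α n)] at elimination
  have saddle : |n - ∑' k, divisorWeight 1 α k| ≤ 4 / α := by
    rw [abs_sub_comm, hn]
    exact abs_tsum_divisorWeight_one_sub_le hα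
  have first_moment_nonneg : 0 ≤ ∑' k : ℕ, k * divisorWeight 0 α k :=
    tsum_nonneg fun k ↦ mul_nonneg k.cast_nonneg (divisorWeight_nonneg 0 α k)
  have a_nonneg := partitionWeight_nonneg α n
  refine elimination.trans ?_
  gcongr

theorem exp_neg_mul_abs_expectedSummands_sub_le {n : ℕ} (hα : 0 < α)
    (hn : (n : ℝ) = Real.pi ^ 2 / (6 * α ^ 2)) :
    Real.exp (-α) *
        (|expectedSummands n - ∑' k, divisorWeight 0 α k| * partitionWeight α n) ≤
      (8 * α * partitionWeight α n + 256 / α ^ 2 * secondMoment (partitionWeight α)) *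
        ∑' k, divisorWeight 0 (α / 2) k := by
  have elimination := tsum_mul_divisorWeight_one_mul_abs_expectedSummands_sub_le hα hn
  have zero_one := tsum_pow_mul_divisorWeight_le 0 hα 1
  have zero_two := tsum_pow_mul_divisorWeight_le 0 hα 2
  have one_one := tsum_pow_mul_divisorWeight_one_le hα 1
  have one_two := tsum_pow_mul_divisorWeight_one_le hα 2
  simp only [pow_one, Nat.factorial_one, Nat.factorial_two, Nat.cast_one, Nat.cast_ofNat]
    at zero_one zero_two one_one one_two
  set a := partitionWeight α n
  set D := ∑' k, divisorWeight 0 (α / 2) k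
  set M := secondMoment (partitionWeight α)
  have a_nonneg : 0 ≤ a := partitionWeight_nonneg α n
  have M_nonneg : 0 ≤ M := secondMoment_nonneg _
  have D_nonneg : 0 ≤ D := tsum_nonneg (divisorWeight_nonneg 0 _)
  have second_moment_nonneg (s : ℕ) : 0 ≤ ∑' k : ℕ, (k : ℝ) ^ 2 * divisorWeight s α k :=
    tsum_nonneg fun k ↦ mul_nonneg (by positivity) (divisorWeight_nonneg s α k)
  calc Real.exp (-α) * (|expectedSummands n - ∑' k, divisorWeight 0 α k| * a)
      = α ^ 3 * (Real.exp (-α) / α ^ 3 *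
          (|expectedSummands n - ∑' k, divisorWeight 0 α k| * a)) := by field_simp
    _ ≤ α ^ 3 * ((∑' k : ℕ, k * divisorWeight 1 α k) *
          (|expectedSummands n - ∑' k, divisorWeight 0 α k| * a)) := by
        gcongr
        exact le_tsum_mul_divisorWeight_one hα
    _ ≤ α ^ 3 * (1 * (2 / α) * D * (4 / α * a) +
          (1 * (2 / α) * D * (2 * (2 / α) ^ 2 * (8 / α ^ 2)) +
            1 * (2 / α) * (8 / α ^ 2) * (2 * (2 / α) ^ 2 * D)) * M) := by
        refine mul_le_mul_of_nonneg_left (elimination.trans ?_) (by positivity)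
        gcongr <;> exact second_moment_nonneg _
    _ = (8 * α * a + 256 / α ^ 2 * M) * D := by
        field_simp
        ring

theorem mul_tsum_divisorWeight_zero_half_le (hα : 0 < α) (hα1 : α ≤ 1) :
    α * ∑' k, divisorWeight 0 (α / 2) k ≤ 8 * (Real.eulerMascheroniConstant - Real.log α) := by
  have h := (abs_le.1 (abs_mul_tsum_divisorWeight_zero_sub_le (half_pos hα))).2
  rw [Real.log_div hα.ne' two_ne_zero] at h
  linarith [Real.log_nonpos hα.le hα1, Real.one_half_lt_eulerMascheroniConstant,
    Real.log_two_lt_d9]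

theorem abs_tsum_divisorWeight_zero_sub_div_le (hα : 0 < α) :
    |∑' k, divisorWeight 0 α k - (Real.eulerMascheroniConstant - Real.log α) / α| ≤ 1 := by
  refine le_of_mul_le_mul_left ?_ hα
  rw [← abs_of_pos hα, ← abs_mul, abs_of_pos hα, mul_sub, mul_div_cancel₀ _ hα.ne', mul_one]
  exact abs_mul_tsum_divisorWeight_zero_sub_le hα

theorem abs_expectedSummands_sub_tsum_le {K : ℝ} {n : ℕ} (hα : 0 < α) (hα1 : α ≤ 1)
    (hn : (n : ℝ) = Real.pi ^ 2 / (6 * α ^ 2))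
    (hK : secondMoment (partitionWeight α) ≤ K * α ^ 3 * partitionWeight α n) :
    |expectedSummands n - ∑' k, divisorWeight 0 α k| ≤
      3 * (8 + 256 * K) * (α * ∑' k, divisorWeight 0 (α / 2) k) := by
  set a := partitionWeight α n
  set D := ∑' k, divisorWeight 0 (α / 2) k
  set E := |expectedSummands n - ∑' k, divisorWeight 0 α k|
  have a_pos : 0 < a := partitionWeight_pos α n
  have D_nonneg : 0 ≤ D := tsum_nonneg (divisorWeight_nonneg 0 _)
  have third_le_exp : 1 / 3 ≤ Real.exp (-α) := by
    rw [Real.exp_neg, ← one_div]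
    have : Real.exp α ≤ Real.exp 1 := Real.exp_le_exp.2 hα1
    exact one_div_le_one_div_of_le (Real.exp_pos α) (by linarith [Real.exp_one_lt_d9])
  refine le_of_mul_le_mul_right ?_ a_pos
  calc E * a = 3 * (1 / 3 * (E * a)) := by ring
    _ ≤ 3 * (Real.exp (-α) * (E * a)) := by gcongr
    _ ≤ 3 * ((8 * α * a + 256 / α ^ 2 * secondMoment (partitionWeight α)) * D) :=
        mul_le_mul_of_nonneg_left (exp_neg_mul_abs_expectedSummands_sub_le hα hn) (by norm_num)
    _ ≤ 3 * ((8 * α * a + 256 / α ^ 2 * (K * α ^ 3 * a)) * D) := by gcongr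
    _ = 3 * (8 + 256 * K) * (α * D) * a := by field_simp

theorem exists_eventually_abs_expectedSummands_sub_le : ∃ C : ℝ, ∀ᶠ α in 𝓝[>] 0, ∀ n : ℕ,
    (n : ℝ) = Real.pi ^ 2 / (6 * α ^ 2) →
      |expectedSummands n - (Real.eulerMascheroniConstant - Real.log α) / α| ≤
        C * (Real.eulerMascheroniConstant - Real.log α) := by
  obtain ⟨K, K_pos, secondMoment_le⟩ := exists_eventually_secondMoment_partitionWeight_le
  refine ⟨3 * (8 + 256 * K) * 8 + 2, ?_⟩
  filter_upwards [secondMoment_le, Ioc_mem_nhdsGT one_pos] with α secondMoment_le ⟨hα, hα1⟩ n hn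
  set L := Real.eulerMascheroniConstant - Real.log α
  have half_le_L : 1 / 2 ≤ L := by
    linarith [Real.log_nonpos hα.le hα1, Real.one_half_lt_eulerMascheroniConstant]
  calc |expectedSummands n - L / α| ≤ |expectedSummands n - ∑' k, divisorWeight 0 α k| +
        |∑' k, divisorWeight 0 α k - L / α| := abs_sub_le _ _ _
    _ ≤ 3 * (8 + 256 * K) * (α * ∑' k, divisorWeight 0 (α / 2) k) + 1 :=
        add_le_add (abs_expectedSummands_sub_tsum_le hα hα1 hn (secondMoment_le n hn))
          (abs_tsum_divisorWeight_zero_sub_div_le hα)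
    _ ≤ 3 * (8 + 256 * K) * (8 * L) + 1 :=
        add_le_add (mul_le_mul_of_nonneg_left (mul_tsum_divisorWeight_zero_half_le hα hα1)
          (by positivity)) le_rfl
    _ ≤ (3 * (8 + 256 * K) * 8 + 2) * L := by linarith

/-- The parameter at which the tilt concentrates on partitions of `n`, namely the solution `α`
of `n = π² / (6α²)`. -/
noncomputable def saddlePoint (n : ℕ) : ℝ := Real.pi / √(6 * n)

theorem saddlePoint_pos {n : ℕ} (hn : 0 < n) : 0 < saddlePoint n :=
  div_pos Real.pi_pos (by positivity)

theorem natCast_eq_pi_sq_div_saddlePoint_sq {n : ℕ} (hn : 0 < n) :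
    (n : ℝ) = Real.pi ^ 2 / (6 * saddlePoint n ^ 2) := by
  rw [saddlePoint, div_pow, Real.sq_sqrt (by positivity)]
  field_simp

theorem tendsto_saddlePoint : Tendsto saddlePoint atTop (𝓝[>] 0) := by
  refine tendsto_nhdsWithin_iff.2 ⟨?_, (eventually_gt_atTop 0).mono fun n hn ↦ saddlePoint_pos hn⟩
  refine tendsto_const_nhds.div_atTop (Real.tendsto_sqrt_atTop.comp ?_)
  exact tendsto_natCast_atTop_atTop.const_mul_atTop (by norm_num)

theorem isBigO_saddlePoint : saddlePoint =O[atTop] fun n : ℕ ↦ (n : ℝ) ^ (-(1 / 2) : ℝ) := by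
  have saddlePoint_eq (n : ℕ) : saddlePoint n = Real.pi / √6 * (n : ℝ) ^ (-(1 / 2) : ℝ) := by
    rw [saddlePoint, Real.rpow_neg n.cast_nonneg, ← Real.sqrt_eq_rpow, Real.sqrt_mul (by norm_num),
      ← div_div, div_eq_mul_inv (Real.pi / √6)]
  exact (isBigO_refl _ _).const_mul_left _ |>.congr_left fun n ↦ (saddlePoint_eq n).symm

theorem isBigO_expectedSummands_sub :
    (fun n : ℕ ↦ expectedSummands n - √(6 * n) / Real.pi *
      (Real.eulerMascheroniConstant + Real.log (√(6 * n) / Real.pi))) =O[atTop]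
        fun n : ℕ ↦ Real.eulerMascheroniConstant + Real.log (√(6 * n) / Real.pi) := by
  obtain ⟨C, hC⟩ := exists_eventually_abs_expectedSummands_sub_le
  refine IsBigO.of_bound |C| ?_
  filter_upwards [tendsto_saddlePoint.eventually hC, eventually_gt_atTop 0] with n h hn
  have inv_saddlePoint : √(6 * n) / Real.pi = (saddlePoint n)⁻¹ := by rw [saddlePoint, inv_div]
  rw [inv_saddlePoint, Real.log_inv, ← sub_eq_add_neg, mul_comm, ← div_eq_mul_inv, Real.norm_eq_abs,
    Real.norm_eq_abs, ← abs_mul]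
  exact (h n (natCast_eq_pi_sq_div_saddlePoint_sq hn)).trans (le_abs_self _)

theorem eulerMascheroniConstant_add_log_pos {n : ℕ} (hn : 1 ≤ n) :
    0 < Real.eulerMascheroniConstant + Real.log (√(6 * n) / Real.pi) := by
  have one_le_n : (1 : ℝ) ≤ n := by exact_mod_cast hn
  have le_sqrt : (2.4 : ℝ) ≤ √(6 * n) := Real.le_sqrt_of_sq_le (by linarith)
  have le_div : (3 / 4 : ℝ) ≤ √(6 * n) / Real.pi := by
    rw [le_div_iff₀ Real.pi_pos]
    linarith [Real.pi_lt_d2]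
  have le_log : -(1 / 3) ≤ Real.log (3 / 4) := by
    refine le_trans ?_ (Real.one_sub_inv_le_log_of_pos (by norm_num))
    norm_num
  linarith [Real.log_le_log (by norm_num) le_div, Real.one_half_lt_eulerMascheroniConstant]

end ExpectedSummands

theorem mainTheorem9 :
    ∃ ε : ℕ → ℝ,
      (ε =O[atTop] fun n : ℕ => (n : ℝ) ^ (-(1 / 2) : ℝ)) ∧
      ∀ n : ℕ, 1 ≤ n →
        expectedSummands n =
          Real.sqrt (6 * n) / Real.pi *
            (Real.eulerMascheroniConstant + Real.log (Real.sqrt (6 * n) / Real.pi)) *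
            (1 + ε n) := by
  set T : ℕ → ℝ := fun n ↦ √(6 * n) / Real.pi
  set L : ℕ → ℝ := fun n ↦ Real.eulerMascheroniConstant + Real.log (T n)
  have L_ne_zero {n : ℕ} (hn : 1 ≤ n) : L n ≠ 0 := (eulerMascheroniConstant_add_log_pos hn).ne'
  have T_ne_zero {n : ℕ} (hn : 1 ≤ n) : T n ≠ 0 := (div_pos (by positivity) Real.pi_pos).ne'
  refine ⟨fun n ↦ (expectedSummands n - T n * L n) * (T n * L n)⁻¹, ?_, fun n hn ↦ ?_⟩
  · refine ((isBigO_expectedSummands_sub.mul (isBigO_refl _ _)).congr' .rfl ?_).trans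
      isBigO_saddlePoint
    filter_upwards [eventually_ge_atTop 1] with n hn
    rw [mul_inv, mul_left_comm, mul_inv_cancel₀ (L_ne_zero hn), mul_one, inv_div, saddlePoint]
  · have main_ne_zero := mul_ne_zero (T_ne_zero hn) (L_ne_zero hn)
    change _ = T n * L n * (1 + (expectedSummands n - T n * L n) * (T n * L n)⁻¹)
    rw [mul_add, mul_one, mul_comm (_ - _), mul_inv_cancel_left₀ main_ne_zero, add_sub_cancel]
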